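/- Let $N\ge 1$, $\beta>0$, $h,\lambda\in\mathbb R$, $K\ge 0$, and let $0=q_0\le q_1\le\dots\le q_K=Q$ and $0=m_0\le m_1\le\dots\le m_K\le m_{K+1}=1$ be real numbers. Let $J_{ij}$ and $J^a_i$ ($1\le i,j\le N$, $1\le a\le K$) be independent standard Gaussian variables; write $\mathbb E_0$ for the average over all $J_{ij}$, $\mathbb E_a$ for the average over $J^a_1,\dots,J^a_N$, $\mathbb E$ for the average over all of them, and $\mathbb E_z$ for the average over a standard Gaussian vector $z\in\mathbb R^N$. For $t\in[0,1]$ and $C\in\mathbb R$ put $$\tilde Z_N(t)=\mathbb E_z B_t(z),\qquad B_t(z)=\exp\Big(\beta\sqrt{\tfrac{t}{2N}}\sum_{i,j}J_{ij}z_iz_j-t\tfrac{\beta^2}{4N}\big(\sum_i z_i^2\big)^2+\beta\sqrt{1-t}\sum_{a=1}^K\sqrt{q_a-q_{a-1}}\sum_iJ^a_iz_i+(1-t)\tfrac C2\sum_iz_i^2+\beta h\sum_iz_i+\tfrac\lambda2\sum_iz_i^2\Big).$$ Define $Z_K=\tilde Z_N$ and, for $a=K,\dots,1$, $Z_{a-1}=(\mathbb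 E_aZ_a^{m_a})^{1/m_a}$, read as $\exp(\mathbb E_a\log Z_a)$ if $m_a=0$, and let $$\varphi_N(t)=\tfrac1N\,\mathbb E_0\log Z_0 .$$ Put $f_a=Z_a^{m_a}/\mathbb E_aZ_a^{m_a}$ for $1\le a\le K$, $\omega(O)=\tilde Z_N(t)^{-1}\,\mathbb E_z\big(O(z)B_t(z)\big)$, and, for $0\le a\le K$, $\tilde\omega_a(O)=\mathbb E_{a+1}\cdots\mathbb E_K\big(f_{a+1}\cdots f_K\,\omega(O)\big)$ (so $\tilde\omega_K=\omega$), $\tilde\Omega_a=\tilde\omega_a\otimes\tilde\omega_a$ acting on two replicas $z^{(1)},z^{(2)}$, and $\langle F\rangle_a=\mathbb E\big(f_1\cdots f_a\,\tilde\Omega_a(F)\big)$. Let $q_{12}=\frac1N\sum_iz^{(1)}_iz^{(2)}_i$. If $C=-\beta^2\sum_{a=1}^K(q_a-q_{a-1})=-\beta^2Q$, then for every $t\in(0,1)$ the integrals defining $\varphi_N(t)$ converge, $f_1\cdots f_a\,\tilde\Omega_a((q_{12}-q_a)^2)$ is integrable for every $0\le a\le K$, and $\varphi_N$ is differentiable at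 $t$ with $$\frac{d}{dt}\varphi_N(t)=\frac{\beta^2}{4}\sum_{a=0}^K(m_{a+1}-m_a)\,q_a^2-\frac{\beta^2}{4}\sum_{a=0}^K(m_{a+1}-m_a)\,\big\langle(q_{12}-q_a)^2\big\rangle_a .$$ -/

import Mathlib

open MeasureTheory ProbabilityTheory

noncomputable section

namespace GaussianSpinGlass

/-- A piecewise constant functional order parameter with `K` steps:
`0 = q_0 ≤ q_1 ≤ … ≤ q_K` and `0 = m_0 ≤ m_1 ≤ … ≤ m_K ≤ m_{K+1} = 1`. -/
structure StepOrderParameter (K : ℕ) where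
  q : Fin (K + 1) → ℝ
  m : Fin (K + 2) → ℝ
  q_zero : q 0 = 0
  q_mono : Monotone q
  m_zero : m 0 = 0
  m_last : m (Fin.last (K + 1)) = 1
  m_mono : Monotone m

/-- The largest value `Q = q_K` of the overlap. -/
def StepOrderParameter.Q {K : ℕ} (x : StepOrderParameter K) : ℝ := x.q (Fin.last K)

/-- The standard Gaussian measure on `ℝ^N`. -/
def gaussVec (N : ℕ) : Measure (Fin N → ℝ) := Measure.pi fun _ => gaussianReal 0 1

/-- The law of the couplings `J_{ij}`, i.i.d. standard Gaussian. -/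
def couplingLaw (N : ℕ) : Measure (Fin N → Fin N → ℝ) := Measure.pi fun _ => gaussVec N

/-- The law of the fields `J^1, …, J^K`; the field `J^{a+1}` is the coordinate `a : Fin K`. -/
def fieldLaw (N K : ℕ) : Measure (Fin K → Fin N → ℝ) := Measure.pi fun _ => gaussVec N

/-- A realization of the whole external noise: the couplings `J_{ij}` and the fields `J^a_i`. -/
abbrev Noise (N K : ℕ) : Type := (Fin N → Fin N → ℝ) × (Fin K → Fin N → ℝ)

/-- The law of the whole external noise. -/
def noiseLaw (N K : ℕ) : Measure (Noise N K) := (couplingLaw N).prod (fieldLaw N K)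

/-- The average over the single field `J^{a+1}`, all the other noise being kept fixed. -/
def levelAvg {N K : ℕ} (a : Fin K) (g : Noise N K → ℝ) (ξ : Noise N K) : ℝ :=
  ∫ y, g (ξ.1, Function.update ξ.2 a y) ∂(gaussVec N)

/-- The fields `J^1, …, J^a` are taken from `Y`, the fields `J^{a+1}, …, J^K` from `Y'`. -/
def splice {N K : ℕ} (a : Fin (K + 1)) (Y Y' : Fin K → Fin N → ℝ) : Fin K → Fin N → ℝ :=
  fun b => if b.castSucc < a then Y b else Y' b

/-- The average `E_{a+1} ⋯ E_K` over all the fields `J^{a+1}, …, J^K`. -/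
def tailAvg {N K : ℕ} (a : Fin (K + 1)) (g : Noise N K → ℝ) (ξ : Noise N K) : ℝ :=
  ∫ Y', g (ξ.1, splice a ξ.2 Y') ∂(fieldLaw N K)

/-- The exponent of the Boltzmann factor of the interpolating system. -/
def boltzmannExponent {N K : ℕ} (β h lam C : ℝ) (x : StepOrderParameter K) (t : ℝ)
    (ξ : Noise N K) (z : Fin N → ℝ) : ℝ :=
  β * √(t / (2 * N)) * ∑ i, ∑ j, ξ.1 i j * z i * z j
    - t * (β ^ 2 / (4 * N)) * (∑ i, z i ^ 2) ^ 2
    + β * √(1 - t) * ∑ a : Fin K, √(x.q a.succ - x.q a.castSucc) * ∑ i, ξ.2 a i * z i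
    + (1 - t) * (C / 2) * ∑ i, z i ^ 2
    + β * h * ∑ i, z i + lam / 2 * ∑ i, z i ^ 2

/-- The Boltzmann factor of the interpolating system. -/
def boltzmannFactor {N K : ℕ} (β h lam C : ℝ) (x : StepOrderParameter K) (t : ℝ)
    (ξ : Noise N K) (z : Fin N → ℝ) : ℝ :=
  Real.exp (boltzmannExponent β h lam C x t ξ z)

/-- The interpolating partition function. -/
def interpZ {N K : ℕ} (β h lam C : ℝ) (x : StepOrderParameter K) (t : ℝ) (ξ : Noise N K) : ℝ :=
  ∫ z, boltzmannFactor β h lam C x t ξ z ∂(gaussVec N)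

/-- The random variables `Z_K, …, Z_0`, where `Z_K` is the interpolating partition function and
`Z_a = (E_{a+1} Z_{a+1}^{m_{a+1}})^{1 / m_{a+1}}`; for `m_{a+1} = 0` the right-hand side is
its limit as `m_{a+1} → 0`, namely `exp (E_{a+1} log Z_{a+1})`. -/
def levelZ {N K : ℕ} (β h lam C : ℝ) (x : StepOrderParameter K) (t : ℝ) (a : Fin (K + 1)) :
    Noise N K → ℝ :=
  Fin.reverseInduction (motive := fun _ => Noise N K → ℝ)
    (interpZ β h lam C x t)
    (fun b Z ξ =>
      if x.m b.succ.castSucc = 0 then Real.exp (levelAvg b (fun η => Real.log (Z η)) ξ)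
      else (levelAvg b (fun η => Z η ^ x.m b.succ.castSucc) ξ) ^ (1 / x.m b.succ.castSucc))
    a

/-- The interpolating function `φ_N(t) = N⁻¹ E log Z_0`; as `Z_0` depends on the couplings
`J_{ij}` only, the average over the whole noise is the average over the couplings. -/
def interpPhi (N : ℕ) {K : ℕ} (β h lam C : ℝ) (x : StepOrderParameter K) (t : ℝ) : ℝ :=
  1 / (N : ℝ) * ∫ ξ, Real.log (levelZ β h lam C x t 0 ξ) ∂(noiseLaw N K)

/-- The weight `f_{a+1} = Z_{a+1}^{m_{a+1}} / E_{a+1} Z_{a+1}^{m_{a+1}}`, for `a : Fin K`. -/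
def levelWeight {N K : ℕ} (β h lam C : ℝ) (x : StepOrderParameter K) (t : ℝ) (a : Fin K)
    (ξ : Noise N K) : ℝ :=
  levelZ β h lam C x t a.succ ξ ^ x.m a.succ.castSucc /
    levelAvg a (fun η => levelZ β h lam C x t a.succ η ^ x.m a.succ.castSucc) ξ

/-- The product `f_1 ⋯ f_a`. -/
def headWeight {N K : ℕ} (β h lam C : ℝ) (x : StepOrderParameter K) (t : ℝ) (a : Fin (K + 1))
    (ξ : Noise N K) : ℝ :=
  ∏ b : Fin K with b.castSucc < a, levelWeight β h lam C x t b ξ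

/-- The product `f_{a+1} ⋯ f_K`. -/
def tailWeight {N K : ℕ} (β h lam C : ℝ) (x : StepOrderParameter K) (t : ℝ) (a : Fin (K + 1))
    (ξ : Noise N K) : ℝ :=
  ∏ b : Fin K with a ≤ b.castSucc, levelWeight β h lam C x t b ξ

/-- The Boltzmann state `ω`. -/
def gibbs {N K : ℕ} (β h lam C : ℝ) (x : StepOrderParameter K) (t : ℝ)
    (O : (Fin N → ℝ) → ℝ) (ξ : Noise N K) : ℝ :=
  (interpZ β h lam C x t ξ)⁻¹ * ∫ z, O z * boltzmannFactor β h lam C x t ξ z ∂(gaussVec N)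

/-- The state `ω̃_a = E_{a+1} ⋯ E_K (f_{a+1} ⋯ f_K ω(·))`. -/
def levelState {N K : ℕ} (β h lam C : ℝ) (x : StepOrderParameter K) (t : ℝ) (a : Fin (K + 1))
    (O : (Fin N → ℝ) → ℝ) (ξ : Noise N K) : ℝ :=
  tailAvg a (fun η => tailWeight β h lam C x t a η * gibbs β h lam C x t O η) ξ

/-- The state `Ω̃_a` on two replicas, the product of two copies of `ω̃_a` with the same noise. -/
def levelState₂ {N K : ℕ} (β h lam C : ℝ) (x : StepOrderParameter K) (t : ℝ) (a : Fin (K + 1))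
    (F : (Fin N → ℝ) → (Fin N → ℝ) → ℝ) (ξ : Noise N K) : ℝ :=
  levelState β h lam C x t a
    (fun z₁ => levelState β h lam C x t a (fun z₂ => F z₁ z₂) ξ) ξ

/-- The average `⟨F⟩_a = E (f_1 ⋯ f_a Ω̃_a(F))`. -/
def bracket {N K : ℕ} (β h lam C : ℝ) (x : StepOrderParameter K) (t : ℝ) (a : Fin (K + 1))
    (F : (Fin N → ℝ) → (Fin N → ℝ) → ℝ) : ℝ :=
  ∫ ξ, headWeight β h lam C x t a ξ * levelState₂ β h lam C x t a F ξ ∂(noiseLaw N K)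

/-- The overlap `q_{12}` of two configurations. -/
def overlap {N : ℕ} (z₁ z₂ : Fin N → ℝ) : ℝ := 1 / (N : ℝ) * ∑ i, z₁ i * z₂ i

/-- The integrals that define `φ_N(t)` converge. -/
def PhiConverges (N : ℕ) {K : ℕ} (β h lam C : ℝ) (x : StepOrderParameter K) (t : ℝ) : Prop :=
  (∀ ξ : Noise N K, Integrable (boltzmannFactor β h lam C x t ξ) (gaussVec N)) ∧
  (∀ (a : Fin K) (ξ : Noise N K),
    Integrable (fun y => levelZ β h lam C x t a.succ (ξ.1, Function.update ξ.2 a y) ^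
      x.m a.succ.castSucc) (gaussVec N) ∧
    Integrable (fun y => Real.log (levelZ β h lam C x t a.succ
      (ξ.1, Function.update ξ.2 a y))) (gaussVec N)) ∧
  Integrable (fun ξ : Noise N K => Real.log (levelZ β h lam C x t 0 ξ)) (noiseLaw N K)

end GaussianSpinGlass

end

/-
The couplings, the fields and the configuration are the coordinates of a single standard Gaussian
vector, and `log Z_K, …, log Z_0` arise from the energy, that is the exponent of the Boltzmann
factor, by averages of the form `m⁻¹ log E exp (m W)` over successive blocks of coordinates. The
derivative in `t` of the last of them is the average, tilted by `f_1 ⋯ f_K` and the Boltzmann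
weight, of the derivative of the energy. A logarithmic derivative of the tilting density is a
diagonal term minus the replica terms of the levels not below that of the coordinate, weighted by
`m_{b+1} - m_b`, so Gaussian integration by parts turns each coupling into
`⟨F²⟩ - ∑ (m_{b+1} - m_b) ⟨F ⊗ F⟩_b`, where `F` is the product of spins to which it couples, and
likewise for the fields. The quartic term cancels the diagonal terms of the couplings, the choice of
`C` those of the fields, and a summation by parts over the levels completes the square in
`q_12 - q_a`. The quartic term also bounds the energy, uniformly on compact intervals of `t`, by
a quadratic form for which all the averages converge, so that all derivatives can be taken
under the integrals.
-/

noncomputable section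

namespace GaussianSpinGlass

open Set Filter Topology

local notation:max "γ" => fun _ => gaussianReal 0 1

section Averages

variable {ι : Type*} {X : ι → Type*}

open Classical in
/-- The point with the coordinates of `η` on `S` and those of `ω` off `S`. It packages
`Set.piecewise` with classical decidability. -/
def mix (S : Set ι) (η ω : ∀ i, X i) : ∀ i, X i := S.piecewise η ω

lemma mix_of_mem {S : Set ι} {i : ι} (hi : i ∈ S) (η ω : ∀ i, X i) : mix S η ω i = η i := by
  classical exact piecewise_eq_of_mem _ _ _ hi

lemma mix_of_notMem {S : Set ι} {i : ι} (hi : i ∉ S) (η ω : ∀ i, X i) : mix S η ω i = ω i := by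
  classical exact piecewise_eq_of_notMem _ _ _ hi

lemma mix_univ (η ω : ∀ i, X i) : mix univ η ω = η := by
  ext i
  exact mix_of_mem (mem_univ i) η ω

lemma mix_singleton [DecidableEq ι] (i : ι) (η ω : ∀ i, X i) :
    mix {i} η ω = Function.update ω i (η i) := by
  ext j
  rcases eq_or_ne j i with rfl | hj
  · rw [mix_of_mem (mem_singleton j), Function.update_self]
  · rw [mix_of_notMem (mem_singleton_iff.not.2 hj), Function.update_of_ne hj]

lemma mix_update [DecidableEq ι] {S : Set ι} {i : ι} (hi : i ∉ S) (η ω : ∀ i, X i) (s : X i) :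
    mix S η (Function.update ω i s) = Function.update (mix S η ω) i s := by
  ext j
  rcases eq_or_ne j i with rfl | hj
  · rw [mix_of_notMem hi, Function.update_self, Function.update_self]
  · by_cases hS : j ∈ S <;> simp [mix, hS, hj]

lemma mix_union_mix {S T : Set ι} (hST : Disjoint S T) (η η' ω : ∀ i, X i) :
    mix (S ∪ T) (mix S η η') ω = mix T η' (mix S η ω) := by
  ext i
  by_cases hS : i ∈ S
  · have hT : i ∉ T := hST.notMem_of_mem_left hS
    simp [mix, hS, hT]
  · by_cases hT : i ∈ T <;> simp [mix, hS, hT]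

lemma apply_update_of_dependsOn [DecidableEq ι] {β : Type*} {i : ι} {g : (∀ i, X i) → β}
    (hg : DependsOn g {i}ᶜ) (ω : ∀ i, X i) (s : X i) : g (Function.update ω i s) = g ω :=
  hg fun _ hj => Function.update_of_ne hj s ω

lemma apply_mix_of_dependsOn {β : Type*} {S : Set ι} {g : (∀ i, X i) → β} (hg : DependsOn g Sᶜ)
    (η ω : ∀ i, X i) : g (mix S η ω) = g ω := hg fun _ hi => mix_of_notMem hi η ω

variable [∀ i, MeasurableSpace (X i)]

lemma measurable_mix (S : Set ι) :
    Measurable fun p : (∀ i, X i) × (∀ i, X i) => mix S p.1 p.2 := by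
  refine measurable_pi_lambda _ fun i => ?_
  by_cases hi : i ∈ S
  · simp only [mix_of_mem hi]; fun_prop
  · simp only [mix_of_notMem hi]; fun_prop

lemma measurable_mix_left (S : Set ι) (ω : ∀ i, X i) : Measurable fun η => mix S η ω :=
  (measurable_mix S).comp (measurable_id.prodMk measurable_const)

variable [Fintype ι] (μ : ∀ i, Measure (X i))

/-- The average over the coordinates in `S`, the other coordinates being kept fixed. -/
def avg (S : Set ι) (g : (∀ i, X i) → ℝ) (ω : ∀ i, X i) : ℝ := ∫ η, g (mix S η ω) ∂(Measure.pi μ)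

/-- Integrability in the coordinates in `S`, for every value of the other coordinates. -/
def AvgIntegrable (S : Set ι) (g : (∀ i, X i) → ℝ) : Prop :=
  ∀ ω, Integrable (fun η => g (mix S η ω)) (Measure.pi μ)

variable {μ}

lemma avg_univ (g : (∀ i, X i) → ℝ) (ω : ∀ i, X i) : avg μ univ g ω = ∫ η, g η ∂(Measure.pi μ) := by
  simp [avg, mix_univ]

lemma AvgIntegrable.integrable [∀ i, Nonempty (X i)] {g : (∀ i, X i) → ℝ}
    (hg : AvgIntegrable μ univ g) : Integrable g (Measure.pi μ) := by
  simpa [mix_univ] using hg fun _ => Classical.arbitrary _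

lemma avg_update [DecidableEq ι] {S : Set ι} {i : ι} (hi : i ∉ S) (g : (∀ i, X i) → ℝ)
    (ω : ∀ i, X i) (s : X i) :
    avg μ S g (Function.update ω i s) = avg μ S (fun η => g (Function.update η i s)) ω := by
  simp only [avg, mix_update hi]

lemma avg_mul_of_dependsOn {S : Set ι} {f : (∀ i, X i) → ℝ} (hf : DependsOn f Sᶜ)
    (g : (∀ i, X i) → ℝ) (ω : ∀ i, X i) : avg μ S (fun η => f η * g η) ω = f ω * avg μ S g ω := by
  simp only [avg, apply_mix_of_dependsOn hf, integral_const_mul]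

lemma dependsOn_avg {S T : Set ι} {g : (∀ i, X i) → ℝ} (hg : DependsOn g T) :
    DependsOn (avg μ S g) (T \ S) := by
  intro ω ω' h
  refine integral_congr_ae (Eventually.of_forall fun η => hg fun i hi => ?_)
  by_cases hS : i ∈ S
  · simp only [mix_of_mem hS]
  · simpa only [mix_of_notMem hS] using h i ⟨hi, hS⟩

lemma dependsOn_avg_compl (S : Set ι) (g : (∀ i, X i) → ℝ) : DependsOn (avg μ S g) Sᶜ := by
  simpa [compl_eq_univ_sdiff] using dependsOn_avg (S := S) (dependsOn_univ g)

variable [∀ i, IsProbabilityMeasure (μ i)]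

lemma avg_of_dependsOn {S : Set ι} {f : (∀ i, X i) → ℝ} (hf : DependsOn f Sᶜ) :
    avg μ S f = f := by
  funext ω
  simp [avg, apply_mix_of_dependsOn hf]

lemma avg_const (S : Set ι) (r : ℝ) (ω : ∀ i, X i) : avg μ S (fun _ => r) ω = r := by
  simp [avg]

lemma measurable_avg (S : Set ι) {g : (∀ i, X i) → ℝ} (hg : Measurable g) :
    Measurable (avg μ S g) := by
  have h : StronglyMeasurable fun p : (∀ i, X i) × (∀ i, X i) => g (mix S p.2 p.1) :=
    (hg.comp ((measurable_mix S).comp measurable_swap)).stronglyMeasurable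
  exact h.integral_prod_right'.measurable

variable (μ) in
lemma measurePreserving_mix (S : Set ι) :
    MeasurePreserving (fun p : (∀ i, X i) × (∀ i, X i) => mix S p.1 p.2)
      ((Measure.pi μ).prod (Measure.pi μ)) (Measure.pi μ) := by
  classical
  refine ⟨measurable_mix S, (Measure.pi_eq fun s hs => ?_).symm⟩
  rw [Measure.map_apply (measurable_mix S) (MeasurableSet.univ_pi hs)]
  have hpre : (fun p : (∀ i, X i) × (∀ i, X i) => mix S p.1 p.2) ⁻¹' univ.pi s =
      (univ.pi fun i => if i ∈ S then s i else univ) ×ˢ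
        (univ.pi fun i => if i ∈ S then univ else s i) := by
    ext p
    simp only [mem_preimage, Set.mem_pi, mem_univ, true_implies, mem_prod, ← forall_and]
    refine forall_congr' fun i => ?_
    by_cases hi : i ∈ S <;> simp [mix, hi]
  rw [hpre, Measure.prod_prod, Measure.pi_pi, Measure.pi_pi, ← Finset.prod_mul_distrib]
  refine Finset.prod_congr rfl fun i _ => ?_
  by_cases hi : i ∈ S <;> simp [hi]

lemma avgIntegrable_union {S T : Set ι} (hST : Disjoint S T) {g : (∀ i, X i) → ℝ}
    (hg : Measurable g) (hT : AvgIntegrable μ T g)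
    (hS : AvgIntegrable μ S (avg μ T fun η => |g η|)) : AvgIntegrable μ (S ∪ T) g := by
  intro ω
  have hm : Measurable fun η => g (mix (S ∪ T) η ω) := hg.comp (measurable_mix_left _ _)
  rw [← (measurePreserving_mix μ S).integrable_comp hm.aestronglyMeasurable,
    integrable_prod_iff (hm.comp (measurable_mix S)).aestronglyMeasurable]
  simp only [Function.comp_def, mix_union_mix hST]
  exact ⟨Eventually.of_forall fun η => hT (mix S η ω), hS ω⟩

lemma avg_union {S T : Set ι} (hST : Disjoint S T) {g : (∀ i, X i) → ℝ}
    (hg : Measurable g) (h : AvgIntegrable μ (S ∪ T) g) :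
    avg μ (S ∪ T) g = avg μ S (avg μ T g) := by
  funext ω
  have hm : Measurable fun η => g (mix (S ∪ T) η ω) := hg.comp (measurable_mix_left _ _)
  have hi := h ω
  rw [← (measurePreserving_mix μ S).integrable_comp hm.aestronglyMeasurable] at hi
  calc avg μ (S ∪ T) g ω
      = ∫ p, g (mix (S ∪ T) (mix S p.1 p.2) ω) ∂((Measure.pi μ).prod (Measure.pi μ)) := by
        have h := integral_map (μ := (Measure.pi μ).prod (Measure.pi μ))
          (measurable_mix S).aemeasurable hm.aestronglyMeasurable
        rwa [(measurePreserving_mix μ S).map_eq] at h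
    _ = avg μ S (avg μ T g) ω := by
        refine (integral_prod _ hi).trans ?_
        simp only [Function.comp_def, mix_union_mix hST, avg]

lemma integral_avg {g : (∀ i, X i) → ℝ} (T : Set ι) (hm : Measurable g)
    (hg : Integrable g (Measure.pi μ)) :
    ∫ ω, avg μ T g ω ∂(Measure.pi μ) = ∫ ω, g ω ∂(Measure.pi μ) := by
  have hT : ∀ η ω : ∀ i, X i, avg μ T g (mix Tᶜ η ω) = avg μ T g η := fun η ω =>
    dependsOn_avg_compl T g fun i hi => mix_of_mem hi η ω
  have hU : AvgIntegrable μ (Tᶜ ∪ T) g := fun ω => by simpa [compl_union_self, mix_univ] using hg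
  obtain ⟨ω⟩ : Nonempty (∀ i, X i) := (Measure.pi μ).nonempty_of_neZero
  have h := congrFun (avg_union disjoint_compl_left hm hU) ω
  rw [compl_union_self, avg_univ] at h
  rw [h]
  exact integral_congr_ae (Eventually.of_forall fun η => (hT η ω).symm)

lemma integrable_avg {g : (∀ i, X i) → ℝ} (T : Set ι) (hg : Integrable g (Measure.pi μ)) :
    Integrable (avg μ T g) (Measure.pi μ) :=
  ((measurePreserving_mix μ T).integrable_comp_of_integrable hg).swap.integral_prod_left

variable [DecidableEq ι]

lemma avg_singleton {g : (∀ i, X i) → ℝ} (hg : Measurable g) (i : ι) (ω : ∀ i, X i) :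
    avg μ {i} g ω = ∫ s, g (Function.update ω i s) ∂(μ i) := by
  have hi : MeasurePreserving (Function.eval i) (Measure.pi μ) (μ i) := measurePreserving_eval μ i
  have hu : Measurable fun s => g (Function.update ω i s) := hg.comp (measurable_update ω)
  rw [← hi.map_eq, integral_map hi.measurable.aemeasurable hu.aestronglyMeasurable]
  simp only [avg, mix_singleton, Function.eval]

lemma ae_integrable_update {g : (∀ i, X i) → ℝ} (hm : Measurable g)
    (hg : Integrable g (Measure.pi μ)) (i : ι) :
    ∀ᵐ ω ∂(Measure.pi μ), Integrable (fun s => g (Function.update ω i s)) (μ i) := by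
  have hi : MeasurePreserving (Function.eval i) (Measure.pi μ) (μ i) := measurePreserving_eval μ i
  filter_upwards [((measurePreserving_mix μ {i}).integrable_comp_of_integrable hg).prod_left_ae]
    with ω hω
  simp only [Function.comp_def, mix_singleton] at hω
  exact (hi.integrable_comp (hm.comp (measurable_update ω)).aestronglyMeasurable).1 hω

end Averages

section GaussianBounds

variable {ι : Type*} [Fintype ι]

/-- The standard Gaussian measure on `ι → ℝ`, kept reducible so that the lemmas on product measures
apply to it. -/
abbrev stdGauss (ι : Type*) [Fintype ι] : Measure (ι → ℝ) := Measure.pi γ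

lemma integrable_exp_mul_sq_gaussianReal {a : ℝ} (ha : a < 1 / 2) :
    Integrable (fun x : ℝ => Real.exp (a * x ^ 2)) (gaussianReal 0 1) := by
  rw [gaussianReal_of_var_ne_zero _ one_ne_zero,
    integrable_withDensity_iff (measurable_gaussianPDF 0 1) (Eventually.of_forall fun _ =>
      gaussianPDF_lt_top)]
  have h := (integrable_exp_neg_mul_sq (b := 1 / 2 - a) (by linarith)).const_mul
    ((√(2 * Real.pi * (1 : NNReal)))⁻¹)
  refine h.congr (Eventually.of_forall fun x => ?_)
  simp only [toReal_gaussianPDF, gaussianPDFReal]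
  rw [mul_left_comm, ← Real.exp_add]
  congr 2
  simp only [NNReal.coe_one, mul_one, sub_zero]
  ring

lemma integrable_exp_sum_sq {a : ℝ} (ha : a < 1 / 2) :
    Integrable (fun η : ι → ℝ => Real.exp (a * ∑ i, η i ^ 2)) (stdGauss ι) := by
  simpa only [Finset.mul_sum, Real.exp_sum] using
    Integrable.fintype_prod fun _ : ι => integrable_exp_mul_sq_gaussianReal ha

lemma integrable_of_abs_le_exp {g : (ι → ℝ) → ℝ} (hg : Measurable g) {A a : ℝ} (ha : a < 1 / 2)
    (h : ∀ η, |g η| ≤ A * Real.exp (a * ∑ i, η i ^ 2)) : Integrable g (stdGauss ι) :=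
  ((integrable_exp_sum_sq ha).const_mul A).mono' hg.aestronglyMeasurable (Eventually.of_forall h)

lemma sum_sq_nonneg (η : ι → ℝ) : 0 ≤ ∑ i, η i ^ 2 := Finset.sum_nonneg fun _ _ => sq_nonneg _

lemma sq_norm_le_sum_sq (η : ι → ℝ) : ‖η‖ ^ 2 ≤ ∑ i, η i ^ 2 := by
  have h : ‖η‖ ≤ √(∑ i, η i ^ 2) :=
    (pi_norm_le_iff_of_nonneg (Real.sqrt_nonneg _)).2 fun i => Real.abs_le_sqrt <|
      Finset.single_le_sum (f := fun i => η i ^ 2) (fun i _ => sq_nonneg _) (Finset.mem_univ i)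
  calc ‖η‖ ^ 2 ≤ √(∑ i, η i ^ 2) ^ 2 := by gcongr
    _ = _ := Real.sq_sqrt (sum_sq_nonneg η)

lemma exists_one_add_norm_pow_le_exp (k : ℕ) {ε : ℝ} (hε : 0 < ε) :
    ∃ A, ∀ η : ι → ℝ, (1 + ‖η‖) ^ k ≤ A * Real.exp (ε * ∑ i, η i ^ 2) := by
  refine ⟨k.factorial * Real.exp (1 + 1 / (4 * ε)), fun η => ?_⟩
  have hpow := Real.pow_div_factorial_le_exp (1 + ‖η‖) (by positivity) k
  rw [div_le_iff₀' (by positivity)] at hpow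
  have hnorm : ‖η‖ ≤ 1 / (4 * ε) + ε * ‖η‖ ^ 2 := by
    have hsq : 1 / (4 * ε) + ε * ‖η‖ ^ 2 - ‖η‖ = ε * (‖η‖ - 1 / (2 * ε)) ^ 2 := by
      field_simp
      ring
    nlinarith [mul_nonneg hε.le (sq_nonneg (‖η‖ - 1 / (2 * ε)))]
  have hsum : ε * ‖η‖ ^ 2 ≤ ε * ∑ i, η i ^ 2 := by gcongr; exact sq_norm_le_sum_sq η
  calc (1 + ‖η‖) ^ k ≤ k.factorial * Real.exp (1 + ‖η‖) := hpow
    _ ≤ k.factorial * Real.exp (1 + 1 / (4 * ε) + ε * ∑ i, η i ^ 2) :=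
        mul_le_mul_of_nonneg_left (Real.exp_le_exp.2 (by linarith)) (by positivity)
    _ = _ := by rw [Real.exp_add, mul_assoc]

lemma norm_mix_le (S : Set ι) (η ω : ι → ℝ) : ‖mix S η ω‖ ≤ ‖η‖ + ‖ω‖ := by
  refine (pi_norm_le_iff_of_nonneg (by positivity)).2 fun i => ?_
  by_cases hi : i ∈ S
  · rw [mix_of_mem hi]
    linarith [norm_le_pi_norm η i, norm_nonneg ω]
  · rw [mix_of_notMem hi]
    linarith [norm_le_pi_norm ω i, norm_nonneg η]

lemma one_add_norm_mix_pow_le (S : Set ι) (η ω : ι → ℝ) (k : ℕ) :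
    (1 + ‖mix S η ω‖) ^ k ≤ (1 + ‖ω‖) ^ k * (1 + ‖η‖) ^ k := by
  rw [← mul_pow]
  gcongr
  nlinarith [norm_mix_le S η ω, norm_nonneg η, norm_nonneg ω]

end GaussianBounds

section PolyBdd

variable {Θ ι : Type*} [Fintype ι] {I : Set Θ} {F G : Θ → (ι → ℝ) → ℝ}

/-- A family of measurable functions of polynomial growth, uniformly in the parameter. This class is
stable under all the averages of the argument and makes every integrand integrable. -/
structure PolyBdd (I : Set Θ) (F : Θ → (ι → ℝ) → ℝ) : Prop where
  measurable : ∀ θ ∈ I, Measurable (F θ)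
  bound : ∃ (C : ℝ) (k : ℕ), 0 ≤ C ∧ ∀ θ ∈ I, ∀ ω, |F θ ω| ≤ C * (1 + ‖ω‖) ^ k

lemma PolyBdd.of_abs_le (hF : ∀ θ ∈ I, Measurable (F θ)) (hG : PolyBdd I G)
    (h : ∀ θ ∈ I, ∀ ω, |F θ ω| ≤ G θ ω) : PolyBdd I F := by
  obtain ⟨-, C, k, hC, hb⟩ := hG
  exact ⟨hF, C, k, hC, fun θ hθ ω => (h θ hθ ω).trans ((le_abs_self _).trans (hb θ hθ ω))⟩

lemma polyBdd_coeff {a : Θ → ℝ} (h : ∃ C, ∀ θ ∈ I, |a θ| ≤ C) :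
    PolyBdd I fun θ (_ : ι → ℝ) => a θ := by
  obtain ⟨C, hC⟩ := h
  refine ⟨fun θ _ => measurable_const, |C|, 0, abs_nonneg _, fun θ hθ ω => ?_⟩
  simpa using (hC θ hθ).trans (le_abs_self C)

lemma polyBdd_const (r : ℝ) : PolyBdd I fun _ (_ : ι → ℝ) => r :=
  polyBdd_coeff ⟨|r|, fun _ _ => le_rfl⟩

lemma polyBdd_coord (i : ι) : PolyBdd I fun _ (ω : ι → ℝ) => ω i := by
  refine ⟨fun θ _ => measurable_pi_apply i, 1, 1, zero_le_one, fun θ _ ω => ?_⟩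
  have := norm_le_pi_norm ω i
  rw [Real.norm_eq_abs] at this
  linarith

lemma polyBdd_one_add_norm : PolyBdd I fun _ (ω : ι → ℝ) => 1 + ‖ω‖ := by
  refine ⟨fun θ _ => by fun_prop, 1, 1, zero_le_one, fun θ _ ω => ?_⟩
  rw [abs_of_nonneg (by positivity), pow_one, one_mul]

lemma PolyBdd.abs (hF : PolyBdd I F) : PolyBdd I fun θ ω => |F θ ω| := by
  obtain ⟨hm, C, k, hC, hb⟩ := hF
  exact ⟨fun θ hθ => (hm θ hθ).abs, C, k, hC, fun θ hθ ω => (abs_abs _).trans_le (hb θ hθ ω)⟩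

lemma PolyBdd.add (hF : PolyBdd I F) (hG : PolyBdd I G) : PolyBdd I fun θ ω => F θ ω + G θ ω := by
  obtain ⟨hm, C, k, hC, hb⟩ := hF
  obtain ⟨hm', C', k', hC', hb'⟩ := hG
  refine ⟨fun θ hθ => (hm θ hθ).add (hm' θ hθ), C + C', max k k', by positivity,
    fun θ hθ ω => ?_⟩
  have h1 : 1 ≤ 1 + ‖ω‖ := by linarith [norm_nonneg ω]
  calc |F θ ω + G θ ω| ≤ |F θ ω| + |G θ ω| := abs_add_le _ _
    _ ≤ C * (1 + ‖ω‖) ^ k + C' * (1 + ‖ω‖) ^ k' := add_le_add (hb θ hθ ω) (hb' θ hθ ω)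
    _ ≤ C * (1 + ‖ω‖) ^ max k k' + C' * (1 + ‖ω‖) ^ max k k' := by
        gcongr
        exacts [le_max_left _ _, le_max_right _ _]
    _ = _ := by ring

lemma PolyBdd.mul (hF : PolyBdd I F) (hG : PolyBdd I G) : PolyBdd I fun θ ω => F θ ω * G θ ω := by
  obtain ⟨hm, C, k, hC, hb⟩ := hF
  obtain ⟨hm', C', k', hC', hb'⟩ := hG
  refine ⟨fun θ hθ => (hm θ hθ).mul (hm' θ hθ), C * C', k + k', by positivity, fun θ hθ ω => ?_⟩
  rw [abs_mul, pow_add]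
  calc _ ≤ (C * (1 + ‖ω‖) ^ k) * (C' * (1 + ‖ω‖) ^ k') :=
        mul_le_mul (hb θ hθ ω) (hb' θ hθ ω) (abs_nonneg _) (by positivity)
    _ = _ := by ring

lemma PolyBdd.const_mul (hF : PolyBdd I F) (r : ℝ) : PolyBdd I fun θ ω => r * F θ ω :=
  (polyBdd_const r).mul hF

lemma PolyBdd.sub (hF : PolyBdd I F) (hG : PolyBdd I G) : PolyBdd I fun θ ω => F θ ω - G θ ω := by
  simpa only [sub_eq_add_neg, neg_one_mul] using hF.add (hG.const_mul (-1))

lemma PolyBdd.pow (hF : PolyBdd I F) (n : ℕ) : PolyBdd I fun θ ω => F θ ω ^ n := by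
  induction n with
  | zero => simpa only [pow_zero] using polyBdd_const 1
  | succ n ih => simpa only [pow_succ] using ih.mul hF

lemma PolyBdd.sum {κ : Type*} (s : Finset κ) {F : κ → Θ → (ι → ℝ) → ℝ}
    (hF : ∀ j ∈ s, PolyBdd I (F j)) : PolyBdd I fun θ ω => ∑ j ∈ s, F j θ ω := by
  classical
  induction s using Finset.induction_on with
  | empty => simpa only [Finset.sum_empty] using polyBdd_const 0
  | insert j s hj ih =>
    simp only [Finset.sum_insert hj]
    exact (hF j (Finset.mem_insert_self _ _)).add
      (ih fun i hi => hF i (Finset.mem_insert_of_mem hi))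

lemma polyBdd_sum_mul_sq (c : ι → ℝ) : PolyBdd I fun _ (ω : ι → ℝ) => ∑ i, c i * ω i ^ 2 :=
  PolyBdd.sum _ fun i _ => ((polyBdd_coord i).pow 2).const_mul (c i)

lemma PolyBdd.exists_abs_mul_le_exp (hF : PolyBdd I F) (S : Set ι) (ω : ι → ℝ) (r : ℝ) {a : ℝ}
    (ha : a < 1 / 2) : ∃ A, ∃ b < 1 / 2, ∀ θ ∈ I, ∀ (η : ι → ℝ) (w : ℝ),
      |w| ≤ Real.exp (r + a * ∑ i, η i ^ 2) →
        |w * F θ (mix S η ω)| ≤ A * Real.exp (b * ∑ i, η i ^ 2) := by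
  obtain ⟨-, C, k, hC, hb⟩ := hF
  obtain ⟨A, hA⟩ := exists_one_add_norm_pow_le_exp (ι := ι) k (ε := (1 / 2 - a) / 2) (by linarith)
  refine ⟨Real.exp r * (C * (1 + ‖ω‖) ^ k * A), a + (1 / 2 - a) / 2, by linarith,
    fun θ hθ η w hw => ?_⟩
  have hF' : |F θ (mix S η ω)| ≤
      C * (1 + ‖ω‖) ^ k * (A * Real.exp ((1 / 2 - a) / 2 * ∑ i, η i ^ 2)) :=
    calc _ ≤ C * (1 + ‖mix S η ω‖) ^ k := hb θ hθ _
      _ ≤ C * ((1 + ‖ω‖) ^ k * (1 + ‖η‖) ^ k) := by gcongr; exact one_add_norm_mix_pow_le S η ω k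
      _ = C * (1 + ‖ω‖) ^ k * (1 + ‖η‖) ^ k := by ring
      _ ≤ _ := by gcongr; exact hA η
  rw [abs_mul, add_mul, Real.exp_add]
  refine (mul_le_mul hw hF' (abs_nonneg _) (Real.exp_pos _).le).trans (le_of_eq ?_)
  rw [Real.exp_add]
  ring

lemma PolyBdd.avgIntegrable_mul (hF : PolyBdd I F) {S : Set ι} {w : (ι → ℝ) → ℝ} (hw : Measurable w)
    {a : ℝ} (ha : a < 1 / 2)
    (hwr : ∀ ω, ∃ r, ∀ η, |w (mix S η ω)| ≤ Real.exp (r + a * ∑ i, η i ^ 2)) {θ : Θ} (hθ : θ ∈ I) :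
    AvgIntegrable γ S fun η => w η * F θ η := by
  intro ω
  obtain ⟨r, hr⟩ := hwr ω
  obtain ⟨A, b, hb, hA⟩ := hF.exists_abs_mul_le_exp S ω r ha
  exact integrable_of_abs_le_exp ((hw.mul (hF.measurable θ hθ)).comp (measurable_mix_left S ω)) hb
    fun η => hA θ hθ η _ (hr η)

lemma PolyBdd.avgIntegrable (hF : PolyBdd I F) (S : Set ι) {θ : Θ} (hθ : θ ∈ I) :
    AvgIntegrable γ S (F θ) := by
  simpa only [one_mul] using hF.avgIntegrable_mul (S := S) (w := fun _ => 1) measurable_const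
    (a := 0) (by norm_num) (fun _ => ⟨0, by simp⟩) hθ

lemma mul_pow_le_of_le_exp {w r a δ x s : ℝ} (n : ℕ) (hδ : 0 < δ) (hx : 0 ≤ x) (hxs : x ^ 2 ≤ s)
    (hw0 : 0 ≤ w) (hw : w ≤ Real.exp (r + a * s)) :
    w * (1 + x) ^ n ≤ (2 + |r| / δ) ^ n * w + Real.exp ((a + δ) * s) * (1 + x) ^ n := by
  rcases le_total s (|r| / δ) with h | h
  · have hxr : 1 + x ≤ 2 + |r| / δ := by nlinarith
    calc w * (1 + x) ^ n ≤ w * (2 + |r| / δ) ^ n := by gcongr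
      _ = (2 + |r| / δ) ^ n * w := mul_comm _ _
      _ ≤ _ := le_add_of_nonneg_right (by positivity)
  · have hr : r ≤ δ * s := (le_abs_self r).trans (by rwa [div_le_iff₀' hδ] at h)
    calc w * (1 + x) ^ n ≤ Real.exp ((a + δ) * s) * (1 + x) ^ n := by
          gcongr
          exact hw.trans (Real.exp_le_exp.2 (by linarith))
      _ ≤ _ := le_add_of_nonneg_left (by positivity)

lemma abs_mul_le_of_le_exp {w r a δ f B : ℝ} (n : ℕ) {S : Set ι} {η ω : ι → ℝ} (hδ : 0 < δ)
    (hB : 0 ≤ B) (hw0 : 0 ≤ w) (hw : w ≤ Real.exp (r + a * ∑ i, η i ^ 2))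
    (hf : |f| ≤ B * (1 + ‖mix S η ω‖) ^ n) :
    |w * f| ≤ B * (1 + ‖ω‖) ^ n * ((2 + |r| / δ) ^ n * w +
      Real.exp ((a + δ) * ∑ i, η i ^ 2) * (1 + ‖η‖) ^ n) :=
  calc |w * f| = w * |f| := by rw [abs_mul, abs_of_nonneg hw0]
    _ ≤ w * (B * ((1 + ‖ω‖) ^ n * (1 + ‖η‖) ^ n)) := by
        gcongr
        exact hf.trans (by gcongr; exact one_add_norm_mix_pow_le S η ω n)
    _ = B * (1 + ‖ω‖) ^ n * (w * (1 + ‖η‖) ^ n) := by ring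
    _ ≤ _ := by
        gcongr
        exact mul_pow_le_of_le_exp n hδ (norm_nonneg _) (sq_norm_le_sum_sq η) hw0 hw

lemma integrable_exp_sum_sq_mul_pow {b : ℝ} (hb : b < 1 / 2) (n : ℕ) :
    Integrable (fun η : ι → ℝ => Real.exp (b * ∑ i, η i ^ 2) * (1 + ‖η‖) ^ n) (stdGauss ι) := by
  simpa only [mix_univ] using
    ((polyBdd_one_add_norm (I := (univ : Set Unit))).pow n).avgIntegrable_mul
      (S := univ) (w := fun η => Real.exp (b * ∑ i, η i ^ 2)) (by fun_prop) hb
      (fun _ => ⟨0, by simp [mix_univ]⟩) (mem_univ ()) 0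

variable {S : Set ι} {w R : Θ → (ι → ℝ) → ℝ} {a : ℝ}

/- Where `∑ i, η i ^ 2` is small against `R`, the powers of `‖η‖` are bounded by powers of `R`;
elsewhere the weight `w` is below a fixed integrable Gaussian factor. -/
lemma PolyBdd.comp_avg_mul (hF : PolyBdd I F) (hR : PolyBdd I R) (ha : a < 1 / 2)
    (hwm : ∀ θ ∈ I, Measurable (w θ)) (hw0 : ∀ θ ∈ I, ∀ ω, 0 ≤ w θ ω)
    (hw1 : ∀ θ ∈ I, ∀ ω, avg γ S (w θ) ω = 1)
    (hwR : ∀ θ ∈ I, ∀ η ω, w θ (mix S η ω) ≤ Real.exp (R θ ω + a * ∑ i, η i ^ 2)) :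
    PolyBdd I fun θ => avg γ S fun η => w θ η * F θ η := by
  obtain ⟨hFm, B, n, hB, hFb⟩ := id hF
  obtain ⟨δ, hδ, haδ⟩ : ∃ δ > 0, a + δ < 1 / 2 := ⟨(1 / 2 - a) / 2, by linarith, by linarith⟩
  have hE := integrable_exp_sum_sq_mul_pow (ι := ι) haδ n
  set E := ∫ η : ι → ℝ, Real.exp ((a + δ) * ∑ i, η i ^ 2) * (1 + ‖η‖) ^ n ∂(stdGauss ι)
  refine PolyBdd.of_abs_le (fun θ hθ => measurable_avg S ((hwm θ hθ).mul (hFm θ hθ)))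
    (((polyBdd_one_add_norm.pow n).const_mul B).mul
      ((((polyBdd_const 2).add (hR.abs.const_mul δ⁻¹)).pow n).add (polyBdd_const E)))
    fun θ hθ ω => ?_
  have habs : ∀ ω, ∃ r, ∀ η, |w θ (mix S η ω)| ≤ Real.exp (r + a * ∑ i, η i ^ 2) := fun ω =>
    ⟨R θ ω, fun η => (abs_of_nonneg (hw0 θ hθ _)).trans_le (hwR θ hθ η ω)⟩
  have hwi : Integrable (fun η => w θ (mix S η ω)) (stdGauss ι) := by
    simpa only [mul_one] using
      (polyBdd_const (I := I) 1).avgIntegrable_mul (hwm θ hθ) ha habs hθ ω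
  have hwi' := hwi.const_mul ((2 + |R θ ω| / δ) ^ n)
  calc _ ≤ ∫ η, |w θ (mix S η ω) * F θ (mix S η ω)| ∂(stdGauss ι) := abs_integral_le_integral_abs
    _ ≤ _ := integral_mono (hF.avgIntegrable_mul (hwm θ hθ) ha habs hθ ω).abs
        ((hwi'.add hE).const_mul _) fun η =>
          abs_mul_le_of_le_exp n hδ hB (hw0 θ hθ _) (hwR θ hθ η ω) (hFb θ hθ _)
    _ = B * (1 + ‖ω‖) ^ n * ((2 + |R θ ω| / δ) ^ n * avg γ S (w θ) ω + E) := by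
        rw [integral_const_mul]
        congr 1
        exact (integral_add hwi' hE).trans (by rw [integral_const_mul]; rfl)
    _ = _ := by rw [hw1 θ hθ, mul_one, div_eq_inv_mul]

lemma PolyBdd.comp_avg (hF : PolyBdd I F) (S : Set ι) :
    PolyBdd I fun θ => avg γ S (F θ) := by
  simpa only [one_mul] using hF.comp_avg_mul (polyBdd_const 0) (w := fun _ _ => 1) (a := 0)
    (by norm_num) (fun _ _ => measurable_const) (fun _ _ _ => zero_le_one)
    (fun _ _ => avg_const S 1) (by simp)

end PolyBdd

section Tilt

variable {ι : Type*} [Fintype ι]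

/-- The free energy `m⁻¹ log E_S (exp (m W))` left by an average over the coordinates in `S`, read
as its limit `E_S W` for `m = 0`. -/
def logAvg (S : Set ι) (m : ℝ) (W : (ι → ℝ) → ℝ) (ω : ι → ℝ) : ℝ :=
  if m = 0 then avg γ S W ω else 1 / m * Real.log (avg γ S (fun η => Real.exp (m * W η)) ω)

/-- The average over the coordinates in `S` with density proportional to `exp (m W)`. -/
def tilt (S : Set ι) (m : ℝ) (W F : (ι → ℝ) → ℝ) (ω : ι → ℝ) : ℝ :=
  avg γ S (fun η => Real.exp (m * (W η - logAvg S m W η)) * F η) ω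

lemma logAvg_zero (S : Set ι) (W : (ι → ℝ) → ℝ) : logAvg S 0 W = avg γ S W := by
  funext ω
  exact if_pos rfl

lemma logAvg_of_ne_zero (S : Set ι) {m : ℝ} (hm : m ≠ 0) (W : (ι → ℝ) → ℝ) (ω : ι → ℝ) :
    logAvg S m W ω = 1 / m * Real.log (avg γ S (fun η => Real.exp (m * W η)) ω) :=
  if_neg hm

lemma measurable_logAvg (S : Set ι) (m : ℝ) {W : (ι → ℝ) → ℝ} (hW : Measurable W) :
    Measurable (logAvg S m W) := by
  rcases eq_or_ne m 0 with rfl | hm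
  · rw [logAvg_zero]
    exact measurable_avg S hW
  · simp only [funext (logAvg_of_ne_zero S hm W)]
    exact (Real.measurable_log.comp (measurable_avg S (by fun_prop))).const_mul _

lemma dependsOn_logAvg {S T : Set ι} {m : ℝ} {W : (ι → ℝ) → ℝ} (hW : DependsOn W T) :
    DependsOn (logAvg S m W) (T \ S) := by
  intro ω ω' h
  rw [logAvg, logAvg, dependsOn_avg hW h,
    dependsOn_avg (g := fun η => Real.exp (m * W η)) (fun _ _ h' => by simp only [hW h']) h]

lemma dependsOn_logAvg_compl (S : Set ι) (m : ℝ) (W : (ι → ℝ) → ℝ) :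
    DependsOn (logAvg S m W) Sᶜ := by
  simpa only [compl_eq_univ_sdiff] using dependsOn_logAvg (S := S) (m := m) (dependsOn_univ W)

lemma tilt_eq (S : Set ι) (m : ℝ) (W F : (ι → ℝ) → ℝ) (ω : ι → ℝ) :
    tilt S m W F ω = Real.exp (-(m * logAvg S m W ω)) *
      avg γ S (fun η => Real.exp (m * W η) * F η) ω := by
  rw [tilt, ← avg_mul_of_dependsOn (f := fun ω => Real.exp (-(m * logAvg S m W ω)))]
  · congr 1
    funext η
    rw [← mul_assoc, ← Real.exp_add]
    ring_nf
  · intro x y h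
    simp only [dependsOn_logAvg_compl S m W h]

variable {Θ : Type*} {I : Set Θ} {c : ι → ℝ} {S : Set ι} {m : ℝ} {W F : Θ → (ι → ℝ) → ℝ} {θ : Θ}

/-- The exponent `m` and the coefficients `c` of a quadratic bound for which the averages
`E_S (exp (m W))` of energies bounded by `∑ i, c i * ω i ^ 2` converge. -/
structure IsStep (S : Set ι) (m : ℝ) (c : ι → ℝ) : Prop where
  c_nonneg : ∀ i, 0 ≤ c i
  c_lt : ∀ i ∈ S, c i < 1 / 2
  m_nonneg : 0 ≤ m
  m_le_one : m ≤ 1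

/-- A family of energies of polynomial growth, bounded above by `∑ i, c i * ω i ^ 2` up to a
constant. -/
structure IsEnergy (c : ι → ℝ) (I : Set Θ) (W : Θ → (ι → ℝ) → ℝ) : Prop extends PolyBdd I W where
  upper : ∃ C, 0 ≤ C ∧ ∀ θ ∈ I, ∀ ω, W θ ω ≤ C + ∑ i, c i * ω i ^ 2

lemma sum_mul_sq_nonneg {c : ι → ℝ} (hc : ∀ i, 0 ≤ c i) (ω : ι → ℝ) : 0 ≤ ∑ i, c i * ω i ^ 2 :=
  Finset.sum_nonneg fun i _ => mul_nonneg (hc i) (sq_nonneg _)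

namespace IsStep

lemma exists_sum_mul_sq_mix_le (h : IsStep S m c) : ∃ a, 0 ≤ a ∧ a < 1 / 2 ∧
    ∀ η ω, ∑ i, c i * mix S η ω i ^ 2 ≤ ∑ i, c i * ω i ^ 2 + a * ∑ i, η i ^ 2 := by
  obtain ⟨a, ha0, ha, hca⟩ : ∃ a, 0 ≤ a ∧ a < 1 / 2 ∧ ∀ i ∈ S, c i ≤ a := by
    rcases S.eq_empty_or_nonempty with rfl | hS
    · exact ⟨0, le_rfl, by norm_num, by simp⟩
    · obtain ⟨i, hi, hmax⟩ := exists_max_image S c S.toFinite hS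
      exact ⟨c i, h.c_nonneg i, h.c_lt i hi, hmax⟩
  refine ⟨a, ha0, ha, fun η ω => ?_⟩
  rw [Finset.mul_sum, ← Finset.sum_add_distrib]
  refine Finset.sum_le_sum fun i _ => ?_
  by_cases hi : i ∈ S
  · rw [mix_of_mem hi]
    nlinarith [hca i hi, sq_nonneg (η i), mul_nonneg (h.c_nonneg i) (sq_nonneg (ω i))]
  · rw [mix_of_notMem hi]
    nlinarith [sq_nonneg (η i)]

lemma exists_mul_mix_le (h : IsStep S m c) (hW : IsEnergy c I W) : ∃ C a, 0 ≤ C ∧ a < 1 / 2 ∧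
    ∀ θ ∈ I, ∀ η ω,
      m * W θ (mix S η ω) ≤ m * (C + ∑ i, c i * ω i ^ 2) + a * ∑ i, η i ^ 2 := by
  obtain ⟨C, hC, hWC⟩ := hW.upper
  obtain ⟨a, ha0, ha, hmix⟩ := h.exists_sum_mul_sq_mix_le
  refine ⟨C, a, hC, ha, fun θ hθ η ω => ?_⟩
  have hbound : W θ (mix S η ω) ≤ C + ∑ i, c i * ω i ^ 2 + a * ∑ i, η i ^ 2 := by
    linarith [hWC θ hθ (mix S η ω), hmix η ω]
  calc m * W θ (mix S η ω)
      ≤ m * (C + ∑ i, c i * ω i ^ 2) + m * (a * ∑ i, η i ^ 2) := by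
        rw [← mul_add]
        exact mul_le_mul_of_nonneg_left hbound h.m_nonneg
    _ ≤ _ := by
        gcongr m * (C + _) + ?_
        exact mul_le_of_le_one_left (mul_nonneg ha0 (sum_sq_nonneg η)) h.m_le_one

lemma avgIntegrable_exp_mul (h : IsStep S m c) (hW : IsEnergy c I W) (hF : PolyBdd I F)
    (hθ : θ ∈ I) : AvgIntegrable γ S fun η => Real.exp (m * W θ η) * F θ η := by
  obtain ⟨C, a, -, ha, hWa⟩ := h.exists_mul_mix_le hW
  have hWm := hW.measurable θ hθ
  refine hF.avgIntegrable_mul (w := fun η => Real.exp (m * W θ η)) (by fun_prop) ha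
    (fun ω => ⟨m * (C + ∑ i, c i * ω i ^ 2), fun η => ?_⟩) hθ
  rw [Real.abs_exp]
  exact Real.exp_le_exp.2 (hWa θ hθ η ω)

lemma avgIntegrable_exp (h : IsStep S m c) (hW : IsEnergy c I W) (hθ : θ ∈ I) :
    AvgIntegrable γ S fun η => Real.exp (m * W θ η) := by
  simpa only [mul_one] using h.avgIntegrable_exp_mul hW (polyBdd_const 1) hθ

lemma avg_exp_pos (h : IsStep S m c) (hW : IsEnergy c I W) (hθ : θ ∈ I) (ω : ι → ℝ) :
    0 < avg γ S (fun η => Real.exp (m * W θ η)) ω :=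
  integral_exp_pos (h.avgIntegrable_exp hW hθ ω)

lemma exp_mul_logAvg (h : IsStep S m c) (hW : IsEnergy c I W) (hθ : θ ∈ I) (ω : ι → ℝ) :
    Real.exp (m * logAvg S m (W θ) ω) = avg γ S (fun η => Real.exp (m * W θ η)) ω := by
  rcases eq_or_ne m 0 with rfl | hm
  · simp only [zero_mul, Real.exp_zero, avg_const]
  · rw [logAvg_of_ne_zero S hm, ← mul_assoc, mul_one_div_cancel hm, one_mul,
      Real.exp_log (h.avg_exp_pos hW hθ ω)]

lemma avg_le_logAvg (h : IsStep S m c) (hW : IsEnergy c I W) (hθ : θ ∈ I) (ω : ι → ℝ) :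
    avg γ S (W θ) ω ≤ logAvg S m (W θ) ω := by
  rcases h.m_nonneg.eq_or_lt with rfl | hm
  · rw [logAvg_zero]
  · refine le_of_mul_le_mul_left (Real.exp_le_exp.1 ?_) hm
    rw [h.exp_mul_logAvg hW hθ, avg, ← integral_const_mul]
    exact convexOn_exp.map_integral_le Real.continuous_exp.continuousOn isClosed_univ
      (Eventually.of_forall fun _ => mem_univ _) ((hW.avgIntegrable S hθ ω).const_mul m)
      (h.avgIntegrable_exp hW hθ ω)

lemma exists_logAvg_le (h : IsStep S m c) (hm : 0 < m) (hW : IsEnergy c I W) :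
    ∃ C, 0 ≤ C ∧ ∀ θ ∈ I, ∀ ω, logAvg S m (W θ) ω ≤ C + ∑ i, c i * ω i ^ 2 := by
  obtain ⟨C, a, hC, ha, hWa⟩ := h.exists_mul_mix_le hW
  have hE := integrable_exp_sum_sq (ι := ι) ha
  set E := ∫ η : ι → ℝ, Real.exp (a * ∑ i, η i ^ 2) ∂(stdGauss ι)
  have hEpos : 0 < E := integral_exp_pos hE
  refine ⟨C + 1 / m * |Real.log E|, by positivity, fun θ hθ ω => ?_⟩
  have hpos := h.avg_exp_pos hW hθ ω
  have havg : avg γ S (fun η => Real.exp (m * W θ η)) ω ≤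
      Real.exp (m * (C + ∑ i, c i * ω i ^ 2)) * E := by
    rw [← integral_const_mul]
    refine integral_mono (h.avgIntegrable_exp hW hθ ω) (hE.const_mul _) fun η => ?_
    rw [← Real.exp_add]
    exact Real.exp_le_exp.2 (hWa θ hθ η ω)
  calc logAvg S m (W θ) ω
      = 1 / m * Real.log (avg γ S (fun η => Real.exp (m * W θ η)) ω) :=
        logAvg_of_ne_zero S hm.ne' _ ω
    _ ≤ 1 / m * Real.log (Real.exp (m * (C + ∑ i, c i * ω i ^ 2)) * E) := by gcongr
    _ = C + ∑ i, c i * ω i ^ 2 + 1 / m * Real.log E := by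
        rw [Real.log_mul (Real.exp_pos _).ne' hEpos.ne', Real.log_exp]
        field_simp
    _ ≤ C + 1 / m * |Real.log E| + ∑ i, c i * ω i ^ 2 := by
        have := mul_le_mul_of_nonneg_left (le_abs_self (Real.log E)) (one_div_pos.2 hm).le
        linarith

lemma isEnergy_logAvg (h : IsStep S m c) (hW : IsEnergy c I W) :
    IsEnergy c I fun θ => logAvg S m (W θ) := by
  have hupper : ∃ C, 0 ≤ C ∧ ∀ θ ∈ I, ∀ ω, logAvg S m (W θ) ω ≤ C + ∑ i, c i * ω i ^ 2 := by
    rcases h.m_nonneg.eq_or_lt with rfl | hm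
    · have h1 : IsStep S 1 c := { h with m_nonneg := zero_le_one, m_le_one := le_rfl }
      obtain ⟨C, hC, hWC⟩ := h1.exists_logAvg_le one_pos hW
      refine ⟨C, hC, fun θ hθ ω => ?_⟩
      rw [logAvg_zero]
      exact (h1.avg_le_logAvg hW hθ ω).trans (hWC θ hθ ω)
    · exact h.exists_logAvg_le hm hW
  refine ⟨?_, hupper⟩
  obtain ⟨C, hC, hWC⟩ := hupper
  refine PolyBdd.of_abs_le (fun θ hθ => measurable_logAvg S m (hW.measurable θ hθ))
    ((hW.comp_avg S).abs.add ((polyBdd_const C).add (polyBdd_sum_mul_sq c))) fun θ hθ ω => ?_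
  have h0 := sum_mul_sq_nonneg h.c_nonneg ω
  have hJensen := h.avg_le_logAvg hW hθ ω
  exact abs_le.2 ⟨by linarith [neg_abs_le (avg γ S (W θ) ω)],
    by linarith [hWC θ hθ ω, abs_nonneg (avg γ S (W θ) ω)]⟩

lemma avg_exp_sub_logAvg (h : IsStep S m c) (hW : IsEnergy c I W) (hθ : θ ∈ I) (ω : ι → ℝ) :
    avg γ S (fun η => Real.exp (m * (W θ η - logAvg S m (W θ) η))) ω = 1 := by
  have htilt := tilt_eq S m (W θ) (fun _ => 1) ω
  simp only [tilt, mul_one] at htilt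
  rw [htilt, ← h.exp_mul_logAvg hW hθ, ← Real.exp_add, neg_add_cancel, Real.exp_zero]

lemma exists_mul_sub_logAvg_le (h : IsStep S m c) (hW : IsEnergy c I W) : ∃ C a, a < 1 / 2 ∧
    ∀ θ ∈ I, ∀ η ω, m * (W θ (mix S η ω) - logAvg S m (W θ) (mix S η ω)) ≤
      C + ∑ i, c i * ω i ^ 2 + |avg γ S (W θ) ω| + a * ∑ i, η i ^ 2 := by
  obtain ⟨C, a, hC, ha, hWa⟩ := h.exists_mul_mix_le hW
  refine ⟨C, a, ha, fun θ hθ η ω => ?_⟩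
  rw [apply_mix_of_dependsOn (dependsOn_logAvg_compl S m (W θ))]
  have hQ : 0 ≤ C + ∑ i, c i * ω i ^ 2 := add_nonneg hC (sum_mul_sq_nonneg h.c_nonneg ω)
  have hlog : -|avg γ S (W θ) ω| ≤ logAvg S m (W θ) ω :=
    (neg_abs_le _).trans (h.avg_le_logAvg hW hθ ω)
  nlinarith [hWa θ hθ η ω, mul_le_of_le_one_left hQ h.m_le_one,
    mul_le_mul_of_nonneg_left hlog h.m_nonneg,
    mul_le_of_le_one_left (abs_nonneg (avg γ S (W θ) ω)) h.m_le_one]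

lemma avgIntegrable_tilt (h : IsStep S m c) (hW : IsEnergy c I W) (hF : PolyBdd I F) (hθ : θ ∈ I) :
    AvgIntegrable γ S fun η => Real.exp (m * (W θ η - logAvg S m (W θ) η)) * F θ η := by
  obtain ⟨C, a, ha, hle⟩ := h.exists_mul_sub_logAvg_le hW
  have hWm := hW.measurable θ hθ
  have hlm := measurable_logAvg S m hWm
  refine hF.avgIntegrable_mul (w := fun η => Real.exp (m * (W θ η - logAvg S m (W θ) η)))
    (by fun_prop) ha (fun ω => ⟨C + ∑ i, c i * ω i ^ 2 + |avg γ S (W θ) ω|, fun η => ?_⟩) hθ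
  rw [Real.abs_exp]
  exact Real.exp_le_exp.2 (hle θ hθ η ω)

lemma polyBdd_tilt (h : IsStep S m c) (hW : IsEnergy c I W) (hF : PolyBdd I F) :
    PolyBdd I fun θ => tilt S m (W θ) (F θ) := by
  obtain ⟨C, a, ha, hle⟩ := h.exists_mul_sub_logAvg_le hW
  refine hF.comp_avg_mul (w := fun θ η => Real.exp (m * (W θ η - logAvg S m (W θ) η)))
    (((polyBdd_const C).add (polyBdd_sum_mul_sq c)).add (hW.comp_avg S).abs) ha
    (fun θ hθ => ?_) (fun _ _ _ => (Real.exp_pos _).le) (fun θ hθ => h.avg_exp_sub_logAvg hW hθ)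
    fun θ hθ η ω => Real.exp_le_exp.2 (hle θ hθ η ω)
  have hWm := hW.measurable θ hθ
  have hlm := measurable_logAvg S m hWm
  fun_prop

end IsStep

end Tilt

section TiltDeriv

variable {ι : Type*} [Fintype ι] {I : Set ℝ} {c : ι → ℝ} {S : Set ι} {m : ℝ}
  {W W' : ℝ → (ι → ℝ) → ℝ} {θ : ℝ}

lemma hasDerivAt_avg (hI : IsOpen I) {G G' : ℝ → (ι → ℝ) → ℝ}
    (hderiv : ∀ θ ∈ I, ∀ ω, HasDerivAt (fun θ => G θ ω) (G' θ ω) θ)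
    (hG : ∀ θ ∈ I, AvgIntegrable γ S (G θ)) (hG' : ∀ θ ∈ I, AvgIntegrable γ S (G' θ)) {A b : ℝ}
    (hb : b < 1 / 2) {ω : ι → ℝ}
    (hbound : ∀ θ ∈ I, ∀ η, |G' θ (mix S η ω)| ≤ A * Real.exp (b * ∑ i, η i ^ 2)) (hθ : θ ∈ I) :
    HasDerivAt (fun θ => avg γ S (G θ) ω) (avg γ S (G' θ) ω) θ :=
  (hasDerivAt_integral_of_dominated_loc_of_deriv_le (hI.mem_nhds hθ)
    (eventually_of_mem (hI.mem_nhds hθ) fun θ' hθ' => (hG θ' hθ' ω).aestronglyMeasurable)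
    (hG θ hθ ω) (hG' θ hθ ω).aestronglyMeasurable
    (Eventually.of_forall fun η θ' hθ' => hbound θ' hθ' η)
    ((integrable_exp_sum_sq hb).const_mul A)
    (Eventually.of_forall fun _ θ' hθ' => hderiv θ' hθ' _)).2

lemma PolyBdd.hasDerivAt_avg (hI : IsOpen I) (hW : PolyBdd I W) (hW' : PolyBdd I W')
    (hderiv : ∀ θ ∈ I, ∀ ω, HasDerivAt (fun θ => W θ ω) (W' θ ω) θ) (hθ : θ ∈ I) (ω : ι → ℝ) :
    HasDerivAt (fun θ => avg γ S (W θ) ω) (avg γ S (W' θ) ω) θ := by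
  obtain ⟨A, b, hb, hA⟩ := hW'.exists_abs_mul_le_exp S ω 0 (a := 0) (by norm_num)
  exact GaussianSpinGlass.hasDerivAt_avg hI hderiv (fun _ => hW.avgIntegrable S)
    (fun _ => hW'.avgIntegrable S) hb
    (fun θ hθ η => by simpa only [one_mul] using hA θ hθ η 1 (by simp)) hθ

namespace IsStep

lemma hasDerivAt_avg_exp (h : IsStep S m c) (hI : IsOpen I) (hW : IsEnergy c I W)
    (hW' : PolyBdd I W') (hderiv : ∀ θ ∈ I, ∀ ω, HasDerivAt (fun θ => W θ ω) (W' θ ω) θ)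
    (hθ : θ ∈ I) (ω : ι → ℝ) :
    HasDerivAt (fun θ => avg γ S (fun η => Real.exp (m * W θ η)) ω)
      (avg γ S (fun η => Real.exp (m * W θ η) * (m * W' θ η)) ω) θ := by
  obtain ⟨C, a, -, ha, hWa⟩ := h.exists_mul_mix_le hW
  obtain ⟨A, b, hb, hA⟩ := (hW'.const_mul m).exists_abs_mul_le_exp S ω _ ha
  refine hasDerivAt_avg hI (fun θ hθ ω => ((hderiv θ hθ ω).const_mul m).exp)
    (fun _ => h.avgIntegrable_exp hW) (fun _ => h.avgIntegrable_exp_mul hW (hW'.const_mul m)) hb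
    (fun θ hθ η => hA θ hθ η _ ?_) hθ
  rw [Real.abs_exp]
  exact Real.exp_le_exp.2 (hWa θ hθ η ω)

lemma hasDerivAt_logAvg (h : IsStep S m c) (hI : IsOpen I) (hW : IsEnergy c I W)
    (hW' : PolyBdd I W') (hderiv : ∀ θ ∈ I, ∀ ω, HasDerivAt (fun θ => W θ ω) (W' θ ω) θ)
    (hθ : θ ∈ I) (ω : ι → ℝ) :
    HasDerivAt (fun θ => logAvg S m (W θ) ω) (tilt S m (W θ) (W' θ) ω) θ := by
  rcases eq_or_ne m 0 with rfl | hm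
  · simpa only [logAvg_zero, tilt, zero_mul, Real.exp_zero, one_mul] using
      hW.toPolyBdd.hasDerivAt_avg hI hW' hderiv hθ ω
  · simp only [logAvg_of_ne_zero S hm]
    have hlog := (h.hasDerivAt_avg_exp hI hW hW' hderiv hθ ω).log (h.avg_exp_pos hW hθ ω).ne'
    refine (hlog.const_mul (1 / m)).congr_deriv ?_
    have hm_out : avg γ S (fun η => Real.exp (m * W θ η) * (m * W' θ η)) ω =
        m * avg γ S (fun η => Real.exp (m * W θ η) * W' θ η) ω := by
      simp only [avg, ← integral_const_mul, mul_left_comm]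
    rw [tilt_eq, Real.exp_neg, h.exp_mul_logAvg hW hθ, hm_out]
    field_simp

end IsStep

end TiltDeriv

/-- The coordinates `i : ι` are distributed over the levels `0, …, depth`; `m a` is the exponent of
the average over level `a`, and `c` holds the coefficients of a quadratic bound on the energies for
which these averages converge. -/
structure Cascade (ι : Type*) where
  level : ι → ℕ
  depth : ℕ
  m : ℕ → ℝ
  c : ι → ℝ
  level_le : ∀ i, level i ≤ depth
  m_zero : m 0 = 0
  m_depth : m depth = 1
  m_nonneg : ∀ a, 0 ≤ m a
  m_le_one : ∀ a, m a ≤ 1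
  c_nonneg : ∀ i, 0 ≤ c i
  c_lt : ∀ i, level i ≠ 0 → c i < 1 / 2

namespace Cascade

variable {ι : Type*} (P : Cascade ι)

/-- The coordinates of level `a`. -/
def block (a : ℕ) : Set ι := {i | P.level i = a}

/-- The coordinates of level greater than `a`. -/
def above (a : ℕ) : Set ι := {i | a < P.level i}

lemma isStep_block (a : ℕ) : IsStep (P.block (a + 1)) (P.m (a + 1)) P.c where
  c_nonneg := P.c_nonneg
  c_lt i hi := P.c_lt i (hi.trans_ne a.succ_ne_zero)
  m_nonneg := P.m_nonneg _
  m_le_one := P.m_le_one _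

lemma block_union_above (a : ℕ) : P.block (a + 1) ∪ P.above (a + 1) = P.above a := by
  ext i
  simp only [above, block, mem_ofPred_eq, mem_union]
  omega

lemma block_zero_union_above : P.block 0 ∪ P.above 0 = univ := by
  ext i
  simp only [above, block, mem_ofPred_eq, mem_union, mem_univ, iff_true]
  omega

lemma disjoint_block_above (a : ℕ) : Disjoint (P.block a) (P.above a) :=
  Set.disjoint_left.2 fun _ (hi : P.level _ = a) (hi' : a < P.level _) => hi'.ne' hi

lemma above_depth : P.above P.depth = ∅ :=
  Set.eq_empty_of_forall_notMem fun i => (P.level_le i).not_gt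

lemma above_anti {a b : ℕ} (h : a ≤ b) : P.above b ⊆ P.above a := fun _ hi => h.trans_lt hi

variable [Fintype ι]

/-- The free energy left after averaging over the last `j` levels. -/
def energyAux (H : (ι → ℝ) → ℝ) : ℕ → (ι → ℝ) → ℝ
  | 0 => H
  | j + 1 => logAvg (P.block (P.depth - j)) (P.m (P.depth - j)) (energyAux H j)

/-- The free energy left after averaging over the levels greater than `a`. -/
def energy (H : (ι → ℝ) → ℝ) (a : ℕ) : (ι → ℝ) → ℝ := P.energyAux H (P.depth - a)

/-- The tilted average over the last `j` levels. -/
def stateAux (H F : (ι → ℝ) → ℝ) : ℕ → (ι → ℝ) → ℝ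
  | 0 => F
  | j + 1 => tilt (P.block (P.depth - j)) (P.m (P.depth - j)) (P.energyAux H j) (stateAux H F j)

/-- The tilted average over the levels greater than `a`. -/
def state (H : (ι → ℝ) → ℝ) (a : ℕ) (F : (ι → ℝ) → ℝ) : (ι → ℝ) → ℝ :=
  P.stateAux H F (P.depth - a)

/-- The density of the tilted average over level `b + 1`. -/
def weight (H : (ι → ℝ) → ℝ) (b : ℕ) (ω : ι → ℝ) : ℝ :=
  Real.exp (P.m (b + 1) * (P.energy H (b + 1) ω - P.energy H b ω))

/-- The density of the tilted averages over the levels `a + 1, …, b`. -/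
def density (H : (ι → ℝ) → ℝ) (a b : ℕ) (ω : ι → ℝ) : ℝ := ∏ j ∈ Finset.Ico a b, P.weight H j ω

/-- The expectation of `F(ω¹) G(ω²)` over two replicas `ω¹`, `ω²` which share the levels up to `b`
and are conditionally independent beyond. -/
def replica (H : (ι → ℝ) → ℝ) (b : ℕ) (F G : (ι → ℝ) → ℝ) : ℝ :=
  ∫ ω, P.density H 0 b ω * (P.state H b F ω * P.state H b G ω) ∂(stdGauss ι)

lemma energy_depth (H : (ι → ℝ) → ℝ) : P.energy H P.depth = H := by
  rw [energy, Nat.sub_self, energyAux]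

lemma energy_of_lt (H : (ι → ℝ) → ℝ) {a : ℕ} (ha : a < P.depth) :
    P.energy H a = logAvg (P.block (a + 1)) (P.m (a + 1)) (P.energy H (a + 1)) := by
  obtain ⟨j, hj⟩ : ∃ j, P.depth = a + 1 + j := Nat.exists_eq_add_of_le ha
  have h1 : P.depth - a = j + 1 := by omega
  have h2 : P.depth - (a + 1) = j := by omega
  have h3 : P.depth - j = a + 1 := by omega
  rw [energy, energy, h1, h2, energyAux, h3]

lemma state_depth (H F : (ι → ℝ) → ℝ) : P.state H P.depth F = F := by
  rw [state, Nat.sub_self, stateAux]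

lemma state_of_lt (H F : (ι → ℝ) → ℝ) {a : ℕ} (ha : a < P.depth) :
    P.state H a F =
      tilt (P.block (a + 1)) (P.m (a + 1)) (P.energy H (a + 1)) (P.state H (a + 1) F) := by
  obtain ⟨j, hj⟩ : ∃ j, P.depth = a + 1 + j := Nat.exists_eq_add_of_le ha
  have h1 : P.depth - a = j + 1 := by omega
  have h2 : P.depth - (a + 1) = j := by omega
  have h3 : P.depth - j = a + 1 := by omega
  rw [state, state, energy, h1, h2, stateAux, h3]

lemma weight_pos (H : (ι → ℝ) → ℝ) (b : ℕ) (ω : ι → ℝ) : 0 < P.weight H b ω := Real.exp_pos _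

lemma density_pos (H : (ι → ℝ) → ℝ) (a b : ℕ) (ω : ι → ℝ) : 0 < P.density H a b ω :=
  Finset.prod_pos fun _ _ => P.weight_pos H _ ω

lemma density_self (H : (ι → ℝ) → ℝ) (a : ℕ) (ω : ι → ℝ) : P.density H a a ω = 1 := by
  rw [density, Finset.Ico_self, Finset.prod_empty]

lemma density_of_lt (H : (ι → ℝ) → ℝ) {a b : ℕ} (h : a < b) (ω : ι → ℝ) :
    P.density H a b ω = P.weight H a ω * P.density H (a + 1) b ω :=
  Finset.prod_eq_prod_Ico_succ_bot h _

lemma density_mul_density (H : (ι → ℝ) → ℝ) {a b d : ℕ} (hab : a ≤ b) (hbd : b ≤ d) (ω : ι → ℝ) :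
    P.density H a b ω * P.density H b d ω = P.density H a d ω :=
  Finset.prod_Ico_consecutive _ hab hbd

lemma dependsOn_energy (H : (ι → ℝ) → ℝ) {a : ℕ} (ha : a ≤ P.depth) :
    DependsOn (P.energy H a) (P.above a)ᶜ := by
  induction ha using Nat.decreasingInduction with
  | self => simpa only [P.above_depth, compl_empty] using dependsOn_univ (P.energy H P.depth)
  | of_succ a ha ih =>
    rw [P.energy_of_lt H ha, ← P.block_union_above, compl_union, inter_comm, ← sdiff_eq]
    exact dependsOn_logAvg ih

lemma dependsOn_weight (H : (ι → ℝ) → ℝ) {b : ℕ} (hb : b < P.depth) :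
    DependsOn (P.weight H b) (P.above (b + 1))ᶜ := by
  intro x y h
  rw [weight, weight, P.dependsOn_energy H hb h, (P.dependsOn_energy H hb.le).mono
    (compl_subset_compl.2 (P.above_anti b.le_succ)) h]

lemma dependsOn_density (H : (ι → ℝ) → ℝ) (a : ℕ) {b : ℕ} (hb : b ≤ P.depth) :
    DependsOn (P.density H a b) (P.above b)ᶜ := fun _ _ h =>
  Finset.prod_congr rfl fun _ hj =>
    have hjb := (Finset.mem_Ico.1 hj).2
    (P.dependsOn_weight H (hjb.trans_le hb)).mono (compl_subset_compl.2 (P.above_anti hjb)) h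

lemma avg_block_weight_mul (H F : (ι → ℝ) → ℝ) {a : ℕ} (ha : a < P.depth) :
    avg γ (P.block (a + 1)) (fun η => P.weight H a η * F η) =
      tilt (P.block (a + 1)) (P.m (a + 1)) (P.energy H (a + 1)) F := by
  funext ω
  simp only [tilt, weight, P.energy_of_lt H ha]

lemma avg_above_density_mul_of_lt (H F : (ι → ℝ) → ℝ) {a : ℕ} (ha : a < P.depth) :
    avg γ (P.above (a + 1)) (fun η => P.density H a P.depth η * F η) = fun ω => P.weight H a ω *
      avg γ (P.above (a + 1)) (fun η => P.density H (a + 1) P.depth η * F η) ω := by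
  funext ω
  simp only [← avg_mul_of_dependsOn (P.dependsOn_weight H ha), P.density_of_lt H ha, mul_assoc]

variable {P} {Θ : Type*} {I : Set Θ} {H F G : Θ → (ι → ℝ) → ℝ} {θ : Θ} {a : ℕ}

lemma isEnergy_energy (hH : IsEnergy P.c I H) (ha : a ≤ P.depth) :
    IsEnergy P.c I fun θ => P.energy (H θ) a := by
  induction ha using Nat.decreasingInduction with
  | self => simpa only [P.energy_depth] using hH
  | of_succ a ha ih => simpa only [P.energy_of_lt _ ha] using (P.isStep_block a).isEnergy_logAvg ih

lemma polyBdd_state (hH : IsEnergy P.c I H) (hF : PolyBdd I F) (ha : a ≤ P.depth) :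
    PolyBdd I fun θ => P.state (H θ) a (F θ) := by
  induction ha using Nat.decreasingInduction with
  | self => simpa only [P.state_depth] using hF
  | of_succ a ha ih =>
    simpa only [P.state_of_lt _ _ ha] using
      (P.isStep_block a).polyBdd_tilt (isEnergy_energy hH ha) ih

lemma measurable_weight (hH : IsEnergy P.c I H) (hθ : θ ∈ I) (ha : a < P.depth) :
    Measurable (P.weight (H θ) a) := by
  have h := (isEnergy_energy hH ha.le).measurable θ hθ
  have h' := (isEnergy_energy hH (a := a + 1) ha).measurable θ hθ
  unfold weight
  fun_prop

lemma measurable_density (hH : IsEnergy P.c I H) (hθ : θ ∈ I) (a : ℕ) {b : ℕ} (hb : b ≤ P.depth) :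
    Measurable (P.density (H θ) a b) :=
  Finset.measurable_fun_prod _ fun _ hj =>
    measurable_weight hH hθ ((Finset.mem_Ico.1 hj).2.trans_le hb)

lemma measurable_density_mul (hH : IsEnergy P.c I H) (hF : PolyBdd I F) (hθ : θ ∈ I) (a : ℕ) :
    Measurable fun ω => P.density (H θ) a P.depth ω * F θ ω :=
  (measurable_density hH hθ a le_rfl).mul (hF.measurable θ hθ)

lemma avgIntegrable_weight_mul (hH : IsEnergy P.c I H) (hF : PolyBdd I F) (hθ : θ ∈ I)
    (ha : a < P.depth) :
    AvgIntegrable γ (P.block (a + 1)) fun η => P.weight (H θ) a η * F θ η := by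
  simpa only [weight, P.energy_of_lt _ ha] using
    (P.isStep_block a).avgIntegrable_tilt (isEnergy_energy hH ha) hF hθ

lemma avg_density_mul_and_avgIntegrable (hH : IsEnergy P.c I H) (hθ : θ ∈ I) (ha : a ≤ P.depth) :
    ∀ F : Θ → (ι → ℝ) → ℝ, PolyBdd I F →
      avg γ (P.above a) (fun η => P.density (H θ) a P.depth η * F θ η) = P.state (H θ) a (F θ) ∧
      AvgIntegrable γ (P.above a) fun η => P.density (H θ) a P.depth η * F θ η := by
  induction ha using Nat.decreasingInduction with
  | self =>
    intro F hF
    simp only [P.state_depth, P.density_self, one_mul, P.above_depth]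
    exact ⟨avg_of_dependsOn (by simpa only [compl_empty] using dependsOn_univ (F θ)),
      hF.avgIntegrable _ hθ⟩
  | of_succ a ha ih =>
    intro F hF
    have hint : AvgIntegrable γ (P.above a) fun η => P.density (H θ) a P.depth η * F θ η := by
      rw [← P.block_union_above]
      refine avgIntegrable_union (P.disjoint_block_above _) (measurable_density_mul hH hF hθ a)
        (fun ω => ?_) ?_
      · refine (((ih F hF).2 ω).const_mul (P.weight (H θ) a ω)).congr (.of_forall fun η => ?_)
        simp only [P.density_of_lt _ ha, apply_mix_of_dependsOn (P.dependsOn_weight (H θ) ha),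
          mul_assoc]
      · simp only [abs_mul, abs_of_pos (P.density_pos _ _ _ _)]
        rw [P.avg_above_density_mul_of_lt (H θ) _ ha, (ih _ hF.abs).1]
        exact avgIntegrable_weight_mul hH (polyBdd_state hH hF.abs ha) hθ ha
    refine ⟨?_, hint⟩
    rw [← P.block_union_above] at hint ⊢
    rw [avg_union (P.disjoint_block_above _) (measurable_density_mul hH hF hθ a) hint,
      P.avg_above_density_mul_of_lt (H θ) _ ha, (ih F hF).1, P.avg_block_weight_mul _ _ ha,
      P.state_of_lt _ _ ha]

lemma avg_density_mul (hH : IsEnergy P.c I H) (hF : PolyBdd I F) (hθ : θ ∈ I) (ha : a ≤ P.depth) :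
    avg γ (P.above a) (fun η => P.density (H θ) a P.depth η * F θ η) = P.state (H θ) a (F θ) :=
  (avg_density_mul_and_avgIntegrable hH hθ ha F hF).1

lemma avgIntegrable_density_mul (hH : IsEnergy P.c I H) (hF : PolyBdd I F) (hθ : θ ∈ I)
    (ha : a ≤ P.depth) :
    AvgIntegrable γ (P.above a) fun η => P.density (H θ) a P.depth η * F θ η :=
  (avg_density_mul_and_avgIntegrable hH hθ ha F hF).2

end Cascade

namespace Cascade

variable {ι : Type*} [Fintype ι] {P : Cascade ι}

lemma state_const_mul (H F : (ι → ℝ) → ℝ) (r : ℝ) {a : ℕ} (ha : a ≤ P.depth) :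
    P.state H a (fun η => r * F η) = fun ω => r * P.state H a F ω := by
  induction ha using Nat.decreasingInduction with
  | self => simp only [P.state_depth]
  | of_succ a ha ih =>
    funext ω
    simp only [P.state_of_lt _ _ ha, ih, tilt, avg, mul_left_comm _ r, integral_const_mul]

variable {Θ : Type*} {I : Set Θ} {H F G : Θ → (ι → ℝ) → ℝ} {θ : Θ} {a : ℕ}

lemma exp_mul_energy (hH : IsEnergy P.c I H) (hθ : θ ∈ I) (ha : a < P.depth) (ω : ι → ℝ) :
    Real.exp (P.m (a + 1) * P.energy (H θ) a ω) =
      avg γ (P.block (a + 1)) (fun η => Real.exp (P.m (a + 1) * P.energy (H θ) (a + 1) η)) ω := by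
  rw [P.energy_of_lt _ ha]
  exact (P.isStep_block a).exp_mul_logAvg (isEnergy_energy hH ha) hθ ω

lemma state_one (hH : IsEnergy P.c I H) (hθ : θ ∈ I) (ha : a ≤ P.depth) :
    P.state (H θ) a (fun _ => 1) = fun _ => 1 := by
  induction ha using Nat.decreasingInduction with
  | self => exact P.state_depth _ _
  | of_succ a ha ih =>
    funext ω
    simpa only [P.state_of_lt _ _ ha, ih, tilt, mul_one] using
      (P.isStep_block a).avg_exp_sub_logAvg (isEnergy_energy hH ha) hθ ω

lemma state_sum {κ : Type*} (s : Finset κ) {F : κ → Θ → (ι → ℝ) → ℝ} (hH : IsEnergy P.c I H)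
    (hF : ∀ j ∈ s, PolyBdd I (F j)) (hθ : θ ∈ I) (ha : a ≤ P.depth) :
    P.state (H θ) a (fun η => ∑ j ∈ s, F j θ η) =
      fun ω => ∑ j ∈ s, P.state (H θ) a (F j θ) ω := by
  funext ω
  rw [← avg_density_mul hH (F := fun θ η => ∑ j ∈ s, F j θ η) (PolyBdd.sum s hF) hθ ha]
  simp only [avg, Finset.mul_sum]
  rw [integral_finsetSum _ fun j hj => avgIntegrable_density_mul hH (hF j hj) hθ ha ω]
  exact Finset.sum_congr rfl fun j hj => congrFun (avg_density_mul hH (hF j hj) hθ ha) ω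

lemma dependsOn_state (hH : IsEnergy P.c I H) (hF : PolyBdd I F) (hθ : θ ∈ I) (ha : a ≤ P.depth) :
    DependsOn (P.state (H θ) a (F θ)) (P.above a)ᶜ := by
  rw [← avg_density_mul hH hF hθ ha]
  exact dependsOn_avg_compl _ _

lemma integrable_density_mul (hH : IsEnergy P.c I H) (hF : PolyBdd I F) (hθ : θ ∈ I) :
    Integrable (fun ω => P.density (H θ) 0 P.depth ω * F θ ω) (stdGauss ι) := by
  apply AvgIntegrable.integrable
  rw [← P.block_zero_union_above]
  refine avgIntegrable_union (P.disjoint_block_above 0) (measurable_density_mul hH hF hθ 0)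
    (avgIntegrable_density_mul hH hF hθ P.depth.zero_le) ?_
  simp only [abs_mul, abs_of_pos (P.density_pos _ _ _ _)]
  rw [avg_density_mul hH hF.abs hθ P.depth.zero_le]
  exact (polyBdd_state hH hF.abs P.depth.zero_le).avgIntegrable _ hθ

lemma integral_density_mul (hH : IsEnergy P.c I H) (hF : PolyBdd I F) (hθ : θ ∈ I) :
    ∫ ω, P.density (H θ) 0 P.depth ω * F θ ω ∂(stdGauss ι) =
      ∫ ω, P.state (H θ) 0 (F θ) ω ∂(stdGauss ι) := by
  rw [← integral_avg (P.above 0) (measurable_density_mul hH hF hθ 0)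
    (integrable_density_mul hH hF hθ), avg_density_mul hH hF hθ P.depth.zero_le]

lemma avg_density_mul_state (hH : IsEnergy P.c I H) (hF : PolyBdd I F) (hG : PolyBdd I G)
    (hθ : θ ∈ I) (ha : a ≤ P.depth) :
    avg γ (P.above a) (fun ω => P.density (H θ) 0 P.depth ω * (F θ ω * P.state (H θ) a (G θ) ω)) =
      fun ω => P.density (H θ) 0 a ω * (P.state (H θ) a (F θ) ω * P.state (H θ) a (G θ) ω) := by
  have hdep : DependsOn (fun ω => P.density (H θ) 0 a ω * P.state (H θ) a (G θ) ω) (P.above a)ᶜ :=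
    fun x y h => by simp only [P.dependsOn_density _ 0 ha h, dependsOn_state hH hG hθ ha h]
  funext ω
  calc _ = avg γ (P.above a) (fun ω => P.density (H θ) 0 a ω * P.state (H θ) a (G θ) ω *
        (P.density (H θ) a P.depth ω * F θ ω)) ω := by
        congr 1
        funext η
        rw [← P.density_mul_density _ a.zero_le ha]
        ring
    _ = _ := by
        rw [avg_mul_of_dependsOn hdep, avg_density_mul hH hF hθ ha]
        ring

lemma avg_density_mul_state_sdiff (hH : IsEnergy P.c I H) (hF : PolyBdd I F) (hθ : θ ∈ I) {b : ℕ}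
    (hab : a ≤ b) (hb : b ≤ P.depth) :
    avg γ (P.above a \ P.above b) (fun ω => P.density (H θ) a b ω * P.state (H θ) b (F θ) ω) =
      P.state (H θ) a (F θ) := by
  have hunion : P.above a \ P.above b ∪ P.above b = P.above a :=
    sdiff_union_of_subset (P.above_anti hab)
  have hinner : avg γ (P.above b) (fun ω => P.density (H θ) a P.depth ω * F θ ω) =
      fun ω => P.density (H θ) a b ω * P.state (H θ) b (F θ) ω := by
    funext ω
    simp only [← P.density_mul_density (H θ) hab hb, mul_assoc]
    rw [avg_mul_of_dependsOn (P.dependsOn_density (H θ) a hb), avg_density_mul hH hF hθ hb]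
  funext ω
  rw [← hinner, ← avg_union disjoint_sdiff_left (measurable_density_mul hH hF hθ a), hunion,
    avg_density_mul hH hF hθ (hab.trans hb)]
  exact hunion.symm ▸ avgIntegrable_density_mul hH hF hθ (hab.trans hb)

lemma integrable_replica (hH : IsEnergy P.c I H) (hF : PolyBdd I F) (hG : PolyBdd I G)
    (hθ : θ ∈ I) (ha : a ≤ P.depth) :
    Integrable (fun ω => P.density (H θ) 0 a ω *
      (P.state (H θ) a (F θ) ω * P.state (H θ) a (G θ) ω)) (stdGauss ι) := by
  rw [← avg_density_mul_state hH hF hG hθ ha]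
  exact integrable_avg _ (integrable_density_mul hH (hF.mul (polyBdd_state hH hG ha)) hθ)

lemma integral_density_mul_state (hH : IsEnergy P.c I H) (hF : PolyBdd I F) (hG : PolyBdd I G)
    (hθ : θ ∈ I) (ha : a ≤ P.depth) :
    ∫ ω, P.density (H θ) 0 P.depth ω * (F θ ω * P.state (H θ) a (G θ) ω) ∂(stdGauss ι) =
      P.replica (H θ) a (F θ) (G θ) := by
  have hX := hF.mul (polyBdd_state hH hG ha)
  rw [← integral_avg (P.above a) (measurable_density_mul hH hX hθ 0)
    (integrable_density_mul hH hX hθ), avg_density_mul_state hH hF hG hθ ha, replica]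

lemma replica_depth (H F G : (ι → ℝ) → ℝ) :
    P.replica H P.depth F G = ∫ ω, P.density H 0 P.depth ω * (F ω * G ω) ∂(stdGauss ι) := by
  simp only [replica, P.state_depth]

lemma replica_one_right (hH : IsEnergy P.c I H) (hF : PolyBdd I F) (hθ : θ ∈ I)
    (ha : a ≤ P.depth) : P.replica (H θ) a (F θ) (fun _ => 1) =
      ∫ ω, P.density (H θ) 0 P.depth ω * F θ ω ∂(stdGauss ι) := by
  rw [← integral_density_mul_state hH hF (G := fun _ _ => 1) (polyBdd_const 1) hθ ha,
    state_one hH hθ ha]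
  simp only [mul_one]

end Cascade

section CascadeDeriv

namespace Cascade

variable {ι : Type*} [Fintype ι] {P : Cascade ι} {I : Set ℝ} {H H' : ℝ → (ι → ℝ) → ℝ} {a : ℕ}

lemma hasDerivAt_energy (hI : IsOpen I) (hH : IsEnergy P.c I H) (hH' : PolyBdd I H')
    (hderiv : ∀ θ ∈ I, ∀ ω, HasDerivAt (fun θ => H θ ω) (H' θ ω) θ) (ha : a ≤ P.depth) :
    ∀ θ ∈ I, ∀ ω, HasDerivAt (fun θ => P.energy (H θ) a ω) (P.state (H θ) a (H' θ) ω) θ := by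
  induction ha using Nat.decreasingInduction with
  | self => simpa only [P.energy_depth, P.state_depth] using hderiv
  | of_succ a ha ih =>
    intro θ hθ ω
    simp only [P.energy_of_lt _ ha, P.state_of_lt _ _ ha]
    exact (P.isStep_block a).hasDerivAt_logAvg hI (isEnergy_energy hH ha)
      (polyBdd_state hH hH' ha) ih hθ ω

lemma hasDerivAt_integral_energy (hI : IsOpen I) (hH : IsEnergy P.c I H) (hH' : PolyBdd I H')
    (hderiv : ∀ θ ∈ I, ∀ ω, HasDerivAt (fun θ => H θ ω) (H' θ ω) θ) {θ : ℝ} (hθ : θ ∈ I) :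
    HasDerivAt (fun θ => ∫ ω, P.energy (H θ) 0 ω ∂(stdGauss ι))
      (∫ ω, P.density (H θ) 0 P.depth ω * H' θ ω ∂(stdGauss ι)) θ := by
  rw [integral_density_mul hH hH' hθ]
  simpa only [avg_univ] using
    (isEnergy_energy hH P.depth.zero_le).toPolyBdd.hasDerivAt_avg (S := univ) hI
      (polyBdd_state hH hH' P.depth.zero_le) (hasDerivAt_energy hI hH hH' hderiv P.depth.zero_le)
      hθ 0

end Cascade

end CascadeDeriv

section IntegrationByParts

lemma hasDerivAt_gaussianPDFReal (μ : ℝ) (v : NNReal) (x : ℝ) :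
    HasDerivAt (gaussianPDFReal μ v) (-((x - μ) / v * gaussianPDFReal μ v x)) x := by
  have hexponent : HasDerivAt (fun x => -(x - μ) ^ 2 / (2 * v)) (-((x - μ) / v)) x := by
    refine ((((hasDerivAt_id x).sub_const μ).pow 2).neg.div_const (2 * (v : ℝ))).congr_deriv ?_
    simp only [id_eq, Nat.cast_ofNat, Nat.add_one_sub_one, pow_one, mul_one]
    rw [neg_div, mul_div_mul_left _ _ two_ne_zero]
  refine (hexponent.exp.const_mul (√(2 * Real.pi * v))⁻¹).congr_deriv ?_
  rw [gaussianPDFReal]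
  ring

lemma integrable_gaussianReal_iff {μ : ℝ} {v : NNReal} (hv : v ≠ 0) {g : ℝ → ℝ} :
    Integrable g (gaussianReal μ v) ↔ Integrable fun x => g x * gaussianPDFReal μ v x := by
  rw [gaussianReal_of_var_ne_zero _ hv, integrable_withDensity_iff (measurable_gaussianPDF μ v)
    (.of_forall fun _ => gaussianPDF_lt_top)]
  simp only [toReal_gaussianPDF]

lemma integral_sub_mul_gaussianReal {μ : ℝ} {v : NNReal} {g g' : ℝ → ℝ}
    (hderiv : ∀ x, HasDerivAt g (g' x) x) (hg : Integrable g (gaussianReal μ v))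
    (hxg : Integrable (fun x => (x - μ) * g x) (gaussianReal μ v))
    (hg' : Integrable g' (gaussianReal μ v)) :
    ∫ x, (x - μ) * g x ∂(gaussianReal μ v) = v * ∫ x, g' x ∂(gaussianReal μ v) := by
  rcases eq_or_ne v 0 with rfl | hv
  · simp
  have hv' : (v : ℝ) ≠ 0 := by exact_mod_cast hv
  rw [integrable_gaussianReal_iff hv] at hg hxg hg'
  have hparts := integral_mul_deriv_eq_deriv_mul_of_integrable (u := g)
    (v := fun x => v * gaussianPDFReal μ v x)
    (fun x _ => hderiv x) (fun x _ => (hasDerivAt_gaussianPDFReal μ v x).const_mul (v : ℝ))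
    (hxg.neg.congr (.of_forall fun x => by simp only [Pi.neg_apply, Pi.mul_apply]; field_simp))
    ((hg'.const_mul (v : ℝ)).congr (.of_forall fun x => by simp only [Pi.mul_apply]; ring))
    ((hg.const_mul (v : ℝ)).congr (.of_forall fun x => by simp only [Pi.mul_apply]; ring))
  rw [integral_gaussianReal_eq_integral_smul hv, integral_gaussianReal_eq_integral_smul hv]
  simp only [smul_eq_mul]
  calc ∫ x, gaussianPDFReal μ v x * ((x - μ) * g x)
      = -∫ x, g x * (v * -((x - μ) / v * gaussianPDFReal μ v x)) := by
        rw [← integral_neg]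
        congr 1
        funext x
        field_simp
    _ = ∫ x, g' x * (v * gaussianPDFReal μ v x) := by rw [hparts, neg_neg]
    _ = v * ∫ x, gaussianPDFReal μ v x * g' x := by
        rw [← integral_const_mul]
        congr 1
        funext x
        ring

variable {ι : Type*} [Fintype ι] [DecidableEq ι]

lemma integral_coord_mul {g g' : (ι → ℝ) → ℝ} (i : ι)
    (hderiv : ∀ ω s,
      HasDerivAt (fun s => g (Function.update ω i s)) (g' (Function.update ω i s)) s)
    (hm : Measurable g) (hm' : Measurable g') (hg : Integrable g (stdGauss ι))
    (hxg : Integrable (fun ω => ω i * g ω) (stdGauss ι)) (hg' : Integrable g' (stdGauss ι)) :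
    ∫ ω, ω i * g ω ∂(stdGauss ι) = ∫ ω, g' ω ∂(stdGauss ι) := by
  have hxm : Measurable fun ω : ι → ℝ => ω i * g ω := (measurable_pi_apply i).mul hm
  rw [← integral_avg {i} hxm hxg, ← integral_avg {i} hm' hg']
  refine integral_congr_ae ?_
  filter_upwards [ae_integrable_update hm hg i, ae_integrable_update hxm hxg i,
    ae_integrable_update hm' hg' i] with ω h1 h2 h3
  rw [avg_singleton hxm, avg_singleton hm']
  simp only [Function.update_self] at h2 ⊢
  simpa using integral_sub_mul_gaussianReal (hderiv ω) h1 (by simpa using h2) h3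

end IntegrationByParts

section Update

variable {ι : Type*} [Fintype ι] [DecidableEq ι]

lemma logAvg_update {S : Set ι} {i : ι} (hi : i ∉ S) (m : ℝ) (W : (ι → ℝ) → ℝ) (ω : ι → ℝ)
    (s : ℝ) : logAvg S m W (Function.update ω i s) =
      logAvg S m (fun η => W (Function.update η i s)) ω := by
  simp only [logAvg, avg_update hi]

lemma tilt_update {S : Set ι} {i : ι} (hi : i ∉ S) (m : ℝ) (W F : (ι → ℝ) → ℝ) (ω : ι → ℝ)
    (s : ℝ) : tilt S m W F (Function.update ω i s) =
      tilt S m (fun η => W (Function.update η i s)) (fun η => F (Function.update η i s)) ω := by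
  simp only [tilt, avg_update hi, logAvg_update hi]

lemma norm_update_le (ω : ι → ℝ) (i : ι) (s : ℝ) : ‖Function.update ω i s‖ ≤ ‖ω‖ + |s| := by
  refine (pi_norm_le_iff_of_nonneg (by positivity)).2 fun j => ?_
  rcases eq_or_ne j i with rfl | hj
  · rw [Function.update_self, Real.norm_eq_abs]
    linarith [norm_nonneg ω]
  · rw [Function.update_of_ne hj]
    linarith [norm_le_pi_norm ω j, abs_nonneg s]

variable {Θ : Type*} {I : Set Θ} {J : Set ℝ} {F W : Θ → (ι → ℝ) → ℝ} {θ : Θ} {R : ℝ}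

lemma PolyBdd.update (hF : PolyBdd I F) (hθ : θ ∈ I) (hJ : ∀ s ∈ J, |s| ≤ R) (i : ι) :
    PolyBdd J fun s ω => F θ (Function.update ω i s) := by
  obtain ⟨hm, C, k, hC, hb⟩ := hF
  refine .of_abs_le (fun s _ => (hm θ hθ).comp measurable_update_left)
    ((polyBdd_one_add_norm.pow k).const_mul (C * (1 + |R|) ^ k)) fun s hs ω => ?_
  refine (hb θ hθ _).trans ?_
  rw [mul_assoc, ← mul_pow]
  gcongr
  have hs' := (hJ s hs).trans (le_abs_self R)
  nlinarith [norm_update_le ω i s, mul_nonneg (abs_nonneg R) (norm_nonneg ω)]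

lemma IsEnergy.update {c : ι → ℝ} (hc : ∀ i, 0 ≤ c i) (hW : IsEnergy c I W) (hθ : θ ∈ I)
    (hJ : ∀ s ∈ J, |s| ≤ R) (i : ι) : IsEnergy c J fun s ω => W θ (Function.update ω i s) := by
  refine ⟨hW.toPolyBdd.update hθ hJ i, ?_⟩
  obtain ⟨C, hC, hb⟩ := hW.upper
  refine ⟨C + c i * R ^ 2, by have := hc i; positivity, fun s hs ω => (hb θ hθ _).trans ?_⟩
  have hi : c i * s ^ 2 ≤ c i * R ^ 2 :=
    mul_le_mul_of_nonneg_left (sq_le_sq' (abs_le.1 (hJ s hs)).1 (abs_le.1 (hJ s hs)).2) (hc i)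
  have hrest : ∑ j ∈ Finset.univ.erase i, c j * Function.update ω i s j ^ 2 =
      ∑ j ∈ Finset.univ.erase i, c j * ω j ^ 2 := Finset.sum_congr rfl fun j hj => by
    rw [Function.update_of_ne (Finset.ne_of_mem_erase hj)]
  rw [← Finset.add_sum_erase _ _ (Finset.mem_univ i), hrest, Function.update_self,
    ← Finset.add_sum_erase _ (fun j => c j * ω j ^ 2) (Finset.mem_univ i)]
  linarith [mul_nonneg (hc i) (sq_nonneg (ω i))]

end Update

section Interpolation

section LinearEnergy

variable {ι : Type*}

/-- An energy which is affine in each of the coordinates in `T`, when the functions `F i` and `R`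
do not depend on these coordinates. -/
def linearEnergy (T : Finset ι) (a : ι → ℝ) (F : ι → (ι → ℝ) → ℝ) (R : (ι → ℝ) → ℝ) (ω : ι → ℝ) :
    ℝ := ∑ i ∈ T, a i * (ω i * F i ω) + R ω

variable [DecidableEq ι] {T : Finset ι} {F : ι → (ι → ℝ) → ℝ} {R : (ι → ℝ) → ℝ}

lemma hasDerivAt_linearEnergy_update (a : ι → ℝ) (hF : ∀ i ∈ T, DependsOn (F i) (T : Set ι)ᶜ)
    (hR : DependsOn R (T : Set ι)ᶜ) {i : ι} (hi : i ∈ T) (ω : ι → ℝ) (s : ℝ) :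
    HasDerivAt (fun s => linearEnergy T a F R (Function.update ω i s)) (a i * F i ω) s := by
  have hsub : (T : Set ι)ᶜ ⊆ {i}ᶜ := compl_subset_compl.2 (singleton_subset_iff.2 hi)
  have hrest : ∀ s, ∑ j ∈ T.erase i, a j * (Function.update ω i s j *
      F j (Function.update ω i s)) = ∑ j ∈ T.erase i, a j * (ω j * F j ω) := fun s =>
    Finset.sum_congr rfl fun j hj => by
      rw [Function.update_of_ne (Finset.ne_of_mem_erase hj),
        apply_update_of_dependsOn ((hF j (Finset.mem_of_mem_erase hj)).mono hsub)]
  simp only [linearEnergy, ← Finset.add_sum_erase T _ hi, hrest, Function.update_self,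
    apply_update_of_dependsOn (hR.mono hsub), apply_update_of_dependsOn ((hF i hi).mono hsub)]
  have hlin := ((hasDerivAt_id s).mul_const (F i ω)).const_mul (a i)
  rw [one_mul] at hlin
  exact (hlin.add_const _).add_const _

end LinearEnergy

namespace Cascade

variable {ι : Type*} [Fintype ι] (P : Cascade ι)

/-- The functional `⟨F G⟩ - ∑_{b ≥ l} (m_{b+1} - m_b) ⟨F ⊗ G⟩_b`, which integration by parts in a
coordinate of level `l` produces. -/
def replicaCov (H : (ι → ℝ) → ℝ) (l : ℕ) (F G : (ι → ℝ) → ℝ) : ℝ :=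
  P.replica H P.depth F G -
    ∑ b ∈ Finset.Ico l P.depth, (P.m (b + 1) - P.m b) * P.replica H b F G

lemma replicaCov_const_mul_right (H F G : (ι → ℝ) → ℝ) (l : ℕ) (r : ℝ) :
    P.replicaCov H l F (fun ω => r * G ω) = r * P.replicaCov H l F G := by
  have hrep : ∀ b ≤ P.depth,
      P.replica H b F (fun ω => r * G ω) = r * P.replica H b F G := fun b hb => by
    simp only [replica, state_const_mul H G r hb, mul_left_comm _ r, integral_const_mul]
  rw [replicaCov, replicaCov, hrep _ le_rfl, mul_sub, Finset.mul_sum]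
  congr 1
  exact Finset.sum_congr rfl fun b hb => by
    rw [hrep b (Finset.mem_Ico.1 hb).2.le, mul_left_comm]

lemma density_eq_exp (H : (ι → ℝ) → ℝ) (ω : ι → ℝ) : P.density H 0 P.depth ω =
    Real.exp (H ω - ∑ b ∈ Finset.range P.depth, (P.m (b + 1) - P.m b) * P.energy H b ω) := by
  have habel : ∀ n, ∑ b ∈ Finset.range n, P.m (b + 1) * (P.energy H (b + 1) ω - P.energy H b ω) =
      P.m n * P.energy H n ω -
        ∑ b ∈ Finset.range n, (P.m (b + 1) - P.m b) * P.energy H b ω := fun n => by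
    induction n with
    | zero => simp [P.m_zero]
    | succ n ih => rw [Finset.sum_range_succ, Finset.sum_range_succ, ih]; ring
  simp only [density, weight, ← Real.exp_sum, ← Finset.range_eq_Ico]
  rw [habel, P.m_depth, P.energy_depth, one_mul]

variable {P}

section Update

variable [DecidableEq ι] {i : ι} {a : ℕ}

lemma energy_update (H : (ι → ℝ) → ℝ) (ha : a ≤ P.depth) (hi : P.level i ≤ a) (ω : ι → ℝ) (s : ℝ) :
    P.energy H a (Function.update ω i s) =
      P.energy (fun η => H (Function.update η i s)) a ω := by
  induction ha using Nat.decreasingInduction generalizing ω with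
  | self => simp only [P.energy_depth]
  | of_succ a ha ih =>
    have hi' : i ∉ P.block (a + 1) := (Nat.lt_succ_of_le hi).ne
    simp only [P.energy_of_lt _ ha, logAvg_update hi', ih (Nat.le_succ_of_le hi)]

lemma state_update (H F : (ι → ℝ) → ℝ) (ha : a ≤ P.depth) (hi : P.level i ≤ a) (ω : ι → ℝ)
    (s : ℝ) : P.state H a F (Function.update ω i s) =
      P.state (fun η => H (Function.update η i s)) a (fun η => F (Function.update η i s)) ω := by
  induction ha using Nat.decreasingInduction generalizing ω with
  | self => simp only [P.state_depth]
  | of_succ a ha ih =>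
    have hi' : i ∉ P.block (a + 1) := (Nat.lt_succ_of_le hi).ne
    simp only [P.state_of_lt _ _ ha, tilt_update hi', ih (Nat.le_succ_of_le hi),
      energy_update H ha (Nat.le_succ_of_le hi)]

variable {Θ : Type*} {I : Set Θ} {H F H' : Θ → (ι → ℝ) → ℝ} {θ : Θ}

lemma hasDerivAt_energy_update (hH : IsEnergy P.c I H) (hH' : PolyBdd I H') (hθ : θ ∈ I)
    (hderiv : ∀ ω s, HasDerivAt (fun s => H θ (Function.update ω i s))
      (H' θ (Function.update ω i s)) s) (ha : a ≤ P.depth) (hi : P.level i ≤ a) (ω : ι → ℝ)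
    (s : ℝ) : HasDerivAt (fun s => P.energy (H θ) a (Function.update ω i s))
      (P.state (H θ) a (H' θ) (Function.update ω i s)) s := by
  have hJ : ∀ r ∈ Ioo (s - 1) (s + 1), |r| ≤ |s| + 1 := fun r hr => by
    have := abs_sub_lt_iff.2 ⟨sub_lt_iff_lt_add'.2 hr.2, sub_lt_comm.1 hr.1⟩
    linarith [abs_sub_abs_le_abs_sub r s]
  simp only [energy_update _ ha hi, state_update _ _ ha hi]
  exact hasDerivAt_energy isOpen_Ioo (hH.update P.c_nonneg hθ hJ i) (hH'.update hθ hJ i)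
    (fun r _ ω' => hderiv ω' r) ha s ⟨by linarith, by linarith⟩ ω

lemma hasDerivAt_density_update (hH : IsEnergy P.c I H) (hH' : PolyBdd I H') (hθ : θ ∈ I)
    (hderiv : ∀ ω s, HasDerivAt (fun s => H θ (Function.update ω i s))
      (H' θ (Function.update ω i s)) s) (ω : ι → ℝ) (s : ℝ) :
    HasDerivAt (fun s => P.density (H θ) 0 P.depth (Function.update ω i s))
      (P.density (H θ) 0 P.depth (Function.update ω i s) * (H' θ (Function.update ω i s) -
        ∑ b ∈ Finset.Ico (P.level i) P.depth, (P.m (b + 1) - P.m b) *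
          P.state (H θ) b (H' θ) (Function.update ω i s))) s := by
  have hlow : ∀ b ∈ Finset.Ico 0 (P.level i), ∀ s,
      P.energy (H θ) b (Function.update ω i s) = P.energy (H θ) b ω := fun b hb s =>
    have hbi := (Finset.mem_Ico.1 hb).2
    have hsub : (P.above b)ᶜ ⊆ {i}ᶜ := compl_subset_compl.2 (singleton_subset_iff.2 hbi)
    apply_update_of_dependsOn ((P.dependsOn_energy (H θ) (hbi.le.trans (P.level_le i))).mono hsub)
      ω s
  simp only [P.density_eq_exp, Finset.range_eq_Ico,
    ← Finset.sum_Ico_consecutive _ (Nat.zero_le _) (P.level_le i)]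
  simp only [Finset.sum_congr rfl fun b hb => congrArg _ (hlow b hb _), ← sub_sub]
  exact (((hderiv ω s).sub_const _).sub (HasDerivAt.fun_sum fun b hb =>
    (hasDerivAt_energy_update hH hH' hθ hderiv (Finset.mem_Ico.1 hb).2.le (Finset.mem_Ico.1 hb).1
      ω s).const_mul _)).exp

theorem integral_density_mul_coord_mul (hH : IsEnergy P.c I H) (hH' : PolyBdd I H')
    (hF : PolyBdd I F) (hθ : θ ∈ I) (hFi : DependsOn (F θ) {i}ᶜ)
    (hderiv : ∀ ω s, HasDerivAt (fun s => H θ (Function.update ω i s))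
      (H' θ (Function.update ω i s)) s) :
    ∫ ω, P.density (H θ) 0 P.depth ω * (ω i * F θ ω) ∂(stdGauss ι) =
      P.replicaCov (H θ) (P.level i) (F θ) (H' θ) := by
  have hterm : ∀ b ∈ Finset.Ico (P.level i) P.depth, PolyBdd I fun θ ω =>
      (P.m (b + 1) - P.m b) * (F θ ω * P.state (H θ) b (H' θ) ω) := fun b hb =>
    (hF.mul (polyBdd_state hH hH' (Finset.mem_Ico.1 hb).2.le)).const_mul _
  have hlead := hF.mul hH'
  have hD := hlead.sub (PolyBdd.sum _ hterm)
  have hstein := integral_coord_mul i (g := fun ω => P.density (H θ) 0 P.depth ω * F θ ω)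
    (g' := fun ω => P.density (H θ) 0 P.depth ω * (F θ ω * H' θ ω -
      ∑ b ∈ Finset.Ico (P.level i) P.depth,
        (P.m (b + 1) - P.m b) * (F θ ω * P.state (H θ) b (H' θ) ω)))
    (fun ω s => by
      simp only [apply_update_of_dependsOn hFi]
      refine ((hasDerivAt_density_update hH hH' hθ hderiv ω s).mul_const (F θ ω)).congr_deriv ?_
      simp only [mul_left_comm _ (F θ ω), ← Finset.mul_sum]
      ring)
    (measurable_density_mul hH hF hθ 0) (measurable_density_mul hH hD hθ 0)
    (integrable_density_mul hH hF hθ)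
    (by simpa only [mul_left_comm] using integrable_density_mul hH ((polyBdd_coord i).mul hF) hθ)
    (integrable_density_mul hH hD hθ)
  simp only [mul_left_comm _ (_ : ℝ) (F θ _)] at hstein ⊢
  rw [hstein]
  simp only [mul_sub, Finset.mul_sum]
  rw [integral_sub, integral_finsetSum, replicaCov, replica_depth]
  · congr 1
    refine Finset.sum_congr rfl fun b hb => ?_
    rw [← integral_density_mul_state hH hF hH' hθ (Finset.mem_Ico.1 hb).2.le,
      ← integral_const_mul]
    simp only [mul_left_comm]
  · exact fun b hb => integrable_density_mul hH (hterm b hb) hθ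
  · exact integrable_density_mul hH hlead hθ
  · exact integrable_finsetSum _ fun b hb => integrable_density_mul hH (hterm b hb) hθ

end Update

theorem hasDerivAt_integral_energy_linearEnergy {I : Set ℝ} (hI : IsOpen I) {T : Finset ι}
    {a a' : ℝ → ι → ℝ} {F : ι → (ι → ℝ) → ℝ} {R R' : ℝ → (ι → ℝ) → ℝ}
    (hH : IsEnergy P.c I fun θ => linearEnergy T (a θ) F (R θ))
    (hF : ∀ i ∈ T, PolyBdd I fun _ => F i) (hR' : PolyBdd I R')
    (hFT : ∀ i ∈ T, DependsOn (F i) (T : Set ι)ᶜ) (hRT : ∀ θ ∈ I, DependsOn (R θ) (T : Set ι)ᶜ)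
    (ha : ∀ i ∈ T, ∀ θ ∈ I, HasDerivAt (fun θ => a θ i) (a' θ i) θ)
    (ha' : ∀ i ∈ T, ∃ C, ∀ θ ∈ I, |a' θ i| ≤ C)
    (hR : ∀ θ ∈ I, ∀ ω, HasDerivAt (fun θ => R θ ω) (R' θ ω) θ) {θ : ℝ} (hθ : θ ∈ I) :
    HasDerivAt (fun θ => ∫ ω, P.energy (linearEnergy T (a θ) F (R θ)) 0 ω ∂(stdGauss ι))
      (∑ i ∈ T, a θ i * a' θ i *
          P.replicaCov (linearEnergy T (a θ) F (R θ)) (P.level i) (F i) (F i) +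
        ∫ ω, P.density (linearEnergy T (a θ) F (R θ)) 0 P.depth ω * R' θ ω ∂(stdGauss ι)) θ := by
  classical
  have hterm : ∀ i ∈ T, PolyBdd I fun θ ω => a' θ i * (ω i * F i ω) := fun i hi =>
    (polyBdd_coeff (ha' i hi)).mul ((polyBdd_coord i).mul (hF i hi))
  have hint := fun i hi => integrable_density_mul hH (hterm i hi) hθ
  have hibp : ∀ i ∈ T, ∫ ω, P.density (linearEnergy T (a θ) F (R θ)) 0 P.depth ω *
      (a' θ i * (ω i * F i ω)) ∂(stdGauss ι) = a θ i * a' θ i *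
        P.replicaCov (linearEnergy T (a θ) F (R θ)) (P.level i) (F i) (F i) := fun i hi => by
    have hFi : DependsOn (F i) {i}ᶜ :=
      (hFT i hi).mono (compl_subset_compl.2 (singleton_subset_iff.2 hi))
    simp only [mul_left_comm _ (a' θ i), integral_const_mul]
    rw [integral_density_mul_coord_mul hH (H' := fun _ ω => a θ i * F i ω)
      ((hF i hi).const_mul _) (hF i hi) hθ hFi fun ω s => by
        simpa only [apply_update_of_dependsOn hFi] using
          hasDerivAt_linearEnergy_update (a θ) hFT (hRT θ hθ) hi ω s,
      replicaCov_const_mul_right]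
    ring
  refine (hasDerivAt_integral_energy hI hH ((PolyBdd.sum T hterm).add hR') (fun θ hθ ω =>
    (HasDerivAt.fun_sum fun i hi => (ha i hi θ hθ).mul_const _).add (hR θ hθ ω))
    hθ).congr_deriv ?_
  simp only [mul_add, Finset.mul_sum]
  rw [integral_add (integrable_finsetSum _ hint) (integrable_density_mul hH hR' hθ),
    integral_finsetSum _ hint]
  exact congrArg₂ _ (Finset.sum_congr rfl hibp) rfl

end Cascade

end Interpolation

section Sites

lemma measurePreserving_reindex {ι κ : Type*} [Fintype ι] [Fintype κ] {e : κ → ι}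
    (he : Function.Injective e) :
    MeasurePreserving (fun (ω : ι → ℝ) k => ω (e k)) (stdGauss ι) (stdGauss κ) := by
  refine ⟨by fun_prop, ?_⟩
  have h : iIndepFun (fun (i : ι) (ω : ι → ℝ) => ω i) (stdGauss ι) :=
    iIndepFun_pi (X := fun _ => id) fun _ => aemeasurable_id
  rw [(h.precomp he).map_fun_eq_pi_map fun k => (measurable_pi_apply _).aemeasurable, stdGauss]
  congr 1
  funext k
  exact (measurePreserving_eval (fun _ : ι => gaussianReal 0 1) (e k)).map_eq

lemma measurePreserving_curry (ι κ : Type*) [Fintype ι] [Fintype κ] :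
    MeasurePreserving (fun (ω : ι × κ → ℝ) i k => ω (i, k)) (stdGauss (ι × κ))
      (Measure.pi fun _ : ι => stdGauss κ) := by
  refine ⟨by fun_prop, ?_⟩
  have h := Measure.infinitePi_map_curry (ι := ι) (κ := κ) (X := ℝ) fun _ _ => gaussianReal 0 1
  simp only [Measure.infinitePi_eq_pi] at h
  exact h

/-- The indices of all the Gaussian variables: couplings, fields and configuration. -/
abbrev Site (N K : ℕ) : Type := (Fin N × Fin N) ⊕ ((Fin K × Fin N) ⊕ Fin N)

variable {N K : ℕ}

/-- The external noise, as a function of all the Gaussian variables. -/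
def noise (ω : Site N K → ℝ) : Noise N K :=
  (fun i j => ω (.inl (i, j)), fun a i => ω (.inr (.inl (a, i))))

/-- The configuration, as a function of all the Gaussian variables. -/
def cfg (ω : Site N K → ℝ) : Fin N → ℝ := fun i => ω (.inr (.inr i))

/-- The Gaussian variables with a given noise and a vanishing configuration. -/
def liftNoise (ξ : Noise N K) : Site N K → ℝ :=
  Sum.elim (fun p => ξ.1 p.1 p.2) (Sum.elim (fun p => ξ.2 p.1 p.2) fun _ => 0)

lemma noise_liftNoise (ξ : Noise N K) : noise (liftNoise ξ) = ξ := rfl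

lemma measurable_liftNoise : Measurable (liftNoise : Noise N K → Site N K → ℝ) := by
  refine measurable_pi_lambda _ fun s => ?_
  rcases s with p | p | i <;> simp only [liftNoise, Sum.elim_inl, Sum.elim_inr] <;> fun_prop

lemma measurable_of_comp_noise {G : Noise N K → ℝ}
    (hG : Measurable fun ω : Site N K → ℝ => G (noise ω)) : Measurable G := by
  simpa only [Function.comp_def, noise_liftNoise] using hG.comp measurable_liftNoise

lemma measurePreserving_cfg :
    MeasurePreserving (cfg : (Site N K → ℝ) → _) (stdGauss (Site N K)) (gaussVec N) :=
  measurePreserving_reindex (e := fun i : Fin N => (.inr (.inr i) : Site N K))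
    fun _ _ h => Sum.inr_injective (Sum.inr_injective h)

lemma measurePreserving_field (a : Fin K) :
    MeasurePreserving (fun ω : Site N K → ℝ => (noise ω).2 a) (stdGauss (Site N K))
      (gaussVec N) :=
  measurePreserving_reindex (e := fun i : Fin N => (.inr (.inl (a, i)) : Site N K))
    fun _ _ h => (Prod.mk.inj (Sum.inl_injective (Sum.inr_injective h))).2

lemma measurePreserving_fields :
    MeasurePreserving (fun ω : Site N K → ℝ => (noise ω).2) (stdGauss (Site N K))
      (fieldLaw N K) :=
  (measurePreserving_curry (Fin K) (Fin N)).comp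
    (measurePreserving_reindex (e := fun p : Fin K × Fin N => (.inr (.inl p) : Site N K))
      fun _ _ h => Sum.inl_injective (Sum.inr_injective h))

lemma measurePreserving_noise :
    MeasurePreserving (noise : (Site N K → ℝ) → _) (stdGauss (Site N K)) (noiseLaw N K) :=
  ((measurePreserving_curry (Fin N) (Fin N)).prod
    (measurePreserving_curry (Fin K) (Fin N))).comp
    ((measurePreserving_sumPiEquivProdPi
      (X := fun _ : (Fin N × Fin N) ⊕ (Fin K × Fin N) => ℝ) fun _ => gaussianReal 0 1).comp
      (measurePreserving_reindex
        (e := (Sum.map id Sum.inl : (Fin N × Fin N) ⊕ (Fin K × Fin N) → Site N K))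
        (Sum.map_injective.2 ⟨Function.injective_id, Sum.inl_injective⟩)))

lemma integral_noiseLaw {G : Noise N K → ℝ} (hG : Measurable G) :
    ∫ ξ, G ξ ∂(noiseLaw N K) = ∫ ω, G (noise ω) ∂(stdGauss (Site N K)) := by
  rw [← measurePreserving_noise.map_eq, integral_map
    measurePreserving_noise.measurable.aemeasurable hG.aestronglyMeasurable]

lemma integrable_noiseLaw_iff {G : Noise N K → ℝ} (hG : Measurable G) :
    Integrable G (noiseLaw N K) ↔ Integrable (fun ω => G (noise ω)) (stdGauss (Site N K)) :=
  (measurePreserving_noise.integrable_comp hG.aestronglyMeasurable).symm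

/-- The level of a Gaussian variable: `0` for the couplings, `a` for the field `J^a` and `K + 1`
for the configuration. -/
def siteLevel : Site N K → ℕ
  | .inl _ => 0
  | .inr (.inl p) => p.1 + 1
  | .inr (.inr _) => K + 1

/-- The cascade of a step order parameter, whose innermost average is the one over the
configuration. The weight `1 / 8` could be any value in `(0, 1 / 2)`, as the quartic term of the
Hamiltonian absorbs all its quadratic terms. -/
def cascade (N : ℕ) {K : ℕ} (x : StepOrderParameter K) : Cascade (Site N K) where
  level := siteLevel
  depth := K + 1
  m a := if h : a < K + 2 then x.m ⟨a, h⟩ else 1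
  c := Sum.elim (fun _ => 1) fun _ => 1 / 8
  level_le s := by rcases s with p | p | i <;> simp only [siteLevel] <;> omega
  m_zero := by simpa using x.m_zero
  m_depth := (dif_pos (Nat.lt_succ_self _)).trans x.m_last
  m_nonneg a := by
    split_ifs with h
    · exact x.m_zero ▸ x.m_mono (Fin.zero_le _)
    · exact zero_le_one
  m_le_one a := by
    split_ifs with h
    · exact x.m_last ▸ x.m_mono (Fin.le_last _)
    · exact le_rfl
  c_nonneg s := by rcases s with p | s <;> simp
  c_lt s hs := by
    rcases s with p | s
    · exact absurd rfl hs
    · norm_num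

variable (x : StepOrderParameter K)

lemma cascade_m (a : Fin (K + 2)) : (cascade N x).m a = x.m a := by
  simp [cascade]

lemma noise_mix_block (a : Fin K) (η ω : Site N K → ℝ) :
    noise (mix ((cascade N x).block (a + 1)) η ω) =
      ((noise ω).1, Function.update (noise ω).2 a ((noise η).2 a)) := by
  refine Prod.ext ?_ ?_
  · funext i j
    exact mix_of_notMem (by simp [Cascade.block, cascade, siteLevel]) η ω
  · funext b i
    rcases eq_or_ne b a with rfl | h
    · simp only [Function.update_self]
      exact mix_of_mem (by simp [Cascade.block, cascade, siteLevel]) η ω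
    · simp only [Function.update_of_ne h]
      exact mix_of_notMem (by simpa [Cascade.block, cascade, siteLevel, Fin.val_inj] using h) η ω

lemma noise_mix_above_last (η ω : Site N K → ℝ) :
    noise (mix ((cascade N x).above K) η ω) = noise ω := by
  refine Prod.ext ?_ ?_
  · funext i j
    exact mix_of_notMem (by simp [Cascade.above, cascade, siteLevel]) η ω
  · funext b i
    exact mix_of_notMem (by simp [Cascade.above, cascade, siteLevel, b.2]) η ω

lemma cfg_mix_above_last (η ω : Site N K → ℝ) :
    cfg (mix ((cascade N x).above K) η ω) = cfg η := by
  funext i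
  exact mix_of_mem (by simp [Cascade.above, cascade, siteLevel]) η ω

lemma noise_mix_above_sdiff (a : Fin (K + 1)) (η ω : Site N K → ℝ) :
    noise (mix ((cascade N x).above a \ (cascade N x).above K) η ω) =
      ((noise ω).1, splice a (noise ω).2 (noise η).2) := by
  refine Prod.ext ?_ ?_
  · funext i j
    exact mix_of_notMem (by simp [Cascade.above, cascade, siteLevel]) η ω
  · funext b i
    by_cases h : b.castSucc < a
    · simp only [splice, if_pos h]
      refine mix_of_notMem ?_ η ω
      simp only [Cascade.above, cascade, siteLevel, Set.mem_sdiff, mem_ofPred_eq]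
      rw [Fin.lt_def, Fin.val_castSucc] at h
      omega
    · simp only [splice, if_neg h]
      refine mix_of_mem ?_ η ω
      simp only [Cascade.above, cascade, siteLevel, Set.mem_sdiff, mem_ofPred_eq]
      rw [Fin.lt_def, Fin.val_castSucc] at h
      omega

lemma measurable_comp_update {G : Noise N K → ℝ} (hG : Measurable G) (a : Fin K) (ξ : Noise N K) :
    Measurable fun y : Fin N → ℝ => G (ξ.1, Function.update ξ.2 a y) :=
  hG.comp (measurable_const.prodMk (measurable_update ξ.2))

lemma levelAvg_noise {G : Noise N K → ℝ} (hG : Measurable G) (a : Fin K) (ω : Site N K → ℝ) :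
    levelAvg a G (noise ω) = avg γ ((cascade N x).block (a + 1)) (fun η => G (noise η)) ω := by
  rw [levelAvg, ← (measurePreserving_field (N := N) a).map_eq,
    integral_map (measurePreserving_field a).measurable.aemeasurable
      (measurable_comp_update hG a (noise ω)).aestronglyMeasurable]
  simp only [avg, noise_mix_block]

lemma integrable_levelAvg {G : Noise N K → ℝ} (hG : Measurable G) (a : Fin K)
    (hi : AvgIntegrable γ ((cascade N x).block (a + 1)) fun η => G (noise η)) (ξ : Noise N K) :
    Integrable (fun y => G (ξ.1, Function.update ξ.2 a y)) (gaussVec N) := by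
  refine ((measurePreserving_field a).integrable_comp
    (measurable_comp_update hG a ξ).aestronglyMeasurable).1 ?_
  simpa only [noise_mix_block, noise_liftNoise, Function.comp_def] using hi (liftNoise ξ)

lemma measurable_splice (a : Fin (K + 1)) (Y : Fin K → Fin N → ℝ) : Measurable (splice a Y) := by
  refine measurable_pi_lambda _ fun b => ?_
  by_cases h : b.castSucc < a
  · simp only [splice, if_pos h]; fun_prop
  · simp only [splice, if_neg h]; fun_prop

lemma tailAvg_noise {G : Noise N K → ℝ} (hG : Measurable G) (a : Fin (K + 1))
    (ω : Site N K → ℝ) : tailAvg a G (noise ω) =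
      avg γ ((cascade N x).above a \ (cascade N x).above K) (fun η => G (noise η)) ω := by
  have hm : Measurable fun Y' => G ((noise ω).1, splice a (noise ω).2 Y') :=
    hG.comp (measurable_const.prodMk (measurable_splice a _))
  rw [tailAvg, ← (measurePreserving_fields (N := N)).map_eq,
    integral_map measurePreserving_fields.measurable.aemeasurable hm.aestronglyMeasurable]
  simp only [avg, noise_mix_above_sdiff]

end Sites

section Hamiltonian

/-- The sites of the external noise. -/
def noiseSites (N K : ℕ) : Finset (Site N K) := Finset.univ.disjSum (Finset.univ.disjSum ∅)

variable {N K : ℕ}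

lemma sum_noiseSites (f : Site N K → ℝ) : ∑ s ∈ noiseSites N K, f s =
    ∑ i, ∑ j, f (.inl (i, j)) + ∑ a, ∑ i, f (.inr (.inl (a, i))) := by
  simp [noiseSites, Finset.sum_disjSum, Fintype.sum_prod_type]

lemma inr_inr_notMem_noiseSites (i : Fin N) : (.inr (.inr i) : Site N K) ∉ noiseSites N K := by
  simp [noiseSites]

lemma dependsOn_comp_cfg (f : (Fin N → ℝ) → ℝ) :
    DependsOn (fun ω : Site N K → ℝ => f (cfg ω)) (noiseSites N K : Set (Site N K))ᶜ :=
  fun _ _ hxy => congrArg f (funext fun i => hxy _ (inr_inr_notMem_noiseSites i))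

/-- The product of spins to which a coupling or a field is coupled. -/
def spinProd : Site N K → (Fin N → ℝ) → ℝ
  | .inl p, z => z p.1 * z p.2
  | .inr (.inl p), z => z p.2
  | .inr (.inr _), _ => 0

/-- The coefficients of the noise in the Hamiltonian. -/
def noiseCoeff (β : ℝ) (x : StepOrderParameter K) (t : ℝ) : Site N K → ℝ
  | .inl _ => β * √(t / (2 * N))
  | .inr (.inl p) => β * √(1 - t) * √(x.q p.1.succ - x.q p.1.castSucc)
  | .inr (.inr _) => 0

/-- The derivative of `noiseCoeff` in `t`. -/
def noiseCoeffDeriv (β : ℝ) (x : StepOrderParameter K) (t : ℝ) : Site N K → ℝ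
  | .inl _ => β * (1 / (2 * N) / (2 * √(t / (2 * N))))
  | .inr (.inl p) => β * (-1 / (2 * √(1 - t))) * √(x.q p.1.succ - x.q p.1.castSucc)
  | .inr (.inr _) => 0

/-- The noiseless part of the Hamiltonian. -/
def pureHam (β h lam C t : ℝ) (z : Fin N → ℝ) : ℝ :=
  -(t * (β ^ 2 / (4 * N)) * (∑ i, z i ^ 2) ^ 2) + (1 - t) * (C / 2) * ∑ i, z i ^ 2 +
    β * h * ∑ i, z i + lam / 2 * ∑ i, z i ^ 2

/-- The derivative of `pureHam` in `t`. -/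
def pureHamDeriv (β C : ℝ) (z : Fin N → ℝ) : ℝ :=
  -(β ^ 2 / (4 * N) * (∑ i, z i ^ 2) ^ 2) - C / 2 * ∑ i, z i ^ 2

/-- The exponent of the Boltzmann factor, as a function of all the Gaussian variables. -/
def ham (β h lam C : ℝ) (x : StepOrderParameter K) (t : ℝ) : (Site N K → ℝ) → ℝ :=
  linearEnergy (noiseSites N K) (noiseCoeff β x t) (fun s ω => spinProd s (cfg ω))
    fun ω => pureHam β h lam C t (cfg ω)

variable {β h lam C : ℝ} {x : StepOrderParameter K} {t : ℝ}

lemma boltzmannExponent_noise (ω : Site N K → ℝ) :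
    boltzmannExponent β h lam C x t (noise ω) (cfg ω) = ham β h lam C x t ω := by
  simp only [boltzmannExponent, ham, linearEnergy, sum_noiseSites, noiseCoeff, spinProd, pureHam,
    noise, Finset.mul_sum, mul_assoc]
  ring

lemma hasDerivAt_noiseCoeff (hN : N ≠ 0) (ht : t ∈ Ioo (0 : ℝ) 1) (s : Site N K) :
    HasDerivAt (fun t => noiseCoeff β x t s) (noiseCoeffDeriv β x t s) t := by
  rcases s with _ | p | _
  · exact (((hasDerivAt_id t).div_const _).sqrt (div_pos ht.1 (by positivity)).ne').const_mul β
  · exact ((((hasDerivAt_id t).const_sub 1).sqrt (sub_pos.2 ht.2).ne').const_mul β).mul_const _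
  · exact hasDerivAt_const _ _

lemma hasDerivAt_pureHam (t : ℝ) (z : Fin N → ℝ) :
    HasDerivAt (fun t => pureHam β h lam C t z) (pureHamDeriv β C z) t := by
  have hquartic := (((hasDerivAt_id t).mul_const (β ^ 2 / (4 * N))).mul_const
    ((∑ i, z i ^ 2) ^ 2)).neg
  have hquadratic := (((hasDerivAt_id t).const_sub 1).mul_const (C / 2)).mul_const (∑ i, z i ^ 2)
  refine (((hquartic.add hquadratic).add_const (β * h * ∑ i, z i)).add_const
    (lam / 2 * ∑ i, z i ^ 2)).congr_deriv ?_
  rw [pureHamDeriv]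
  ring

lemma noiseCoeff_mul_noiseCoeffDeriv_inl (hN : N ≠ 0) (ht : 0 < t) (p : Fin N × Fin N) :
    noiseCoeff β x t (.inl p) * noiseCoeffDeriv β x t (.inl p) = β ^ 2 / (4 * N) := by
  have hs : √(t / (2 * N)) ≠ 0 := (Real.sqrt_pos.2 (by positivity)).ne'
  simp only [noiseCoeff, noiseCoeffDeriv]
  field_simp
  ring

lemma q_increment_nonneg (x : StepOrderParameter K) (a : Fin K) :
    0 ≤ x.q a.succ - x.q a.castSucc := sub_nonneg.2 (x.q_mono (Fin.castSucc_le_succ a))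

lemma noiseCoeff_mul_noiseCoeffDeriv_inr_inl (ht : t < 1) (p : Fin K × Fin N) :
    noiseCoeff β x t (.inr (.inl p)) * noiseCoeffDeriv β x t (.inr (.inl p)) =
      -(β ^ 2 / 2 * (x.q p.1.succ - x.q p.1.castSucc)) := by
  have hs : √(1 - t) ≠ 0 := (Real.sqrt_pos.2 (sub_pos.2 ht)).ne'
  have hq := Real.mul_self_sqrt (q_increment_nonneg x p.1)
  simp only [noiseCoeff, noiseCoeffDeriv]
  linear_combination -(β ^ 2 / 2) * hq +
    (-(β ^ 2 / 2) * √(x.q p.1.succ - x.q p.1.castSucc) ^ 2) * mul_inv_cancel₀ hs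

lemma sum_q_increments (x : StepOrderParameter K) (b : Fin (K + 1)) :
    ∑ a : Fin K with a.castSucc < b, (x.q a.succ - x.q a.castSucc) = x.q b := by
  induction b using Fin.induction with
  | zero => simp [x.q_zero]
  | succ b ih =>
    have hins : Finset.univ.filter (fun a : Fin K => a.castSucc < b.succ) =
        insert b (Finset.univ.filter fun a : Fin K => a.castSucc < b.castSucc) := by
      ext a
      simp [le_iff_eq_or_lt]
    rw [hins, Finset.sum_insert (by simp), ih, sub_add_cancel]

lemma sum_q_increments_univ (x : StepOrderParameter K) :
    ∑ a : Fin K, (x.q a.succ - x.q a.castSucc) = x.Q := by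
  simpa only [Fin.castSucc_lt_last, Finset.filter_true, StepOrderParameter.Q] using
    sum_q_increments x (Fin.last K)

variable {I : Set ℝ}

lemma exists_abs_le_of_continuousOn_Icc {f : ℝ → ℝ} {u v : ℝ} (hf : ContinuousOn f (Icc u v)) :
    ∃ B, ∀ t ∈ Ioo u v, |f t| ≤ B := by
  obtain ⟨B, hB⟩ := isCompact_Icc.exists_bound_of_continuousOn hf
  exact ⟨B, fun t ht => hB t (Ioo_subset_Icc_self ht)⟩

lemma polyBdd_cfg (i : Fin N) : PolyBdd I fun _ (ω : Site N K → ℝ) => cfg ω i :=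
  polyBdd_coord _

lemma polyBdd_sum_cfg_sq : PolyBdd I fun _ (ω : Site N K → ℝ) => ∑ i, cfg ω i ^ 2 :=
  PolyBdd.sum _ fun i _ => (polyBdd_cfg i).pow 2

lemma polyBdd_spinProd (s : Site N K) :
    PolyBdd I fun _ (ω : Site N K → ℝ) => spinProd s (cfg ω) := by
  rcases s with p | p | _
  exacts [(polyBdd_cfg _).mul (polyBdd_cfg _), polyBdd_cfg _, polyBdd_const 0]

lemma polyBdd_pureHam (u v : ℝ) :
    PolyBdd (Ioo u v) fun t (ω : Site N K → ℝ) => pureHam β h lam C t (cfg ω) := by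
  have hcoeff : ∀ {f : ℝ → ℝ}, Continuous f →
      PolyBdd (Ioo u v) fun t (_ : Site N K → ℝ) => f t := fun hf =>
    polyBdd_coeff (exists_abs_le_of_continuousOn_Icc hf.continuousOn)
  have hquartic := (hcoeff (f := fun t => t * (β ^ 2 / (4 * N))) (by fun_prop)).mul
    (polyBdd_sum_cfg_sq.pow 2)
  have hmag : PolyBdd (Ioo u v) fun _ (ω : Site N K → ℝ) => ∑ i, cfg ω i :=
    PolyBdd.sum _ fun i _ => polyBdd_cfg i
  simpa only [pureHam, neg_one_mul] using (((hquartic.const_mul (-1)).add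
    ((hcoeff (f := fun t => (1 - t) * (C / 2)) (by fun_prop)).mul polyBdd_sum_cfg_sq)).add
    (hmag.const_mul (β * h))).add (polyBdd_sum_cfg_sq.const_mul (lam / 2))

lemma polyBdd_pureHamDeriv :
    PolyBdd I fun _ (ω : Site N K → ℝ) => pureHamDeriv β C (cfg ω) := by
  simpa only [pureHamDeriv, neg_one_mul] using
    (((polyBdd_sum_cfg_sq.pow 2).const_mul (β ^ 2 / (4 * N))).const_mul (-1)).sub
      (polyBdd_sum_cfg_sq.const_mul (C / 2))

lemma polyBdd_ham {u v : ℝ} : PolyBdd (Ioo u v) fun t => ham (N := N) β h lam C x t := by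
  refine (PolyBdd.sum _ fun s _ => (polyBdd_coeff (exists_abs_le_of_continuousOn_Icc ?_)).mul
    ((polyBdd_coord s).mul (polyBdd_spinProd s))).add (polyBdd_pureHam u v)
  rcases s with p | p | i <;> simp only [noiseCoeff] <;> fun_prop

lemma exists_abs_noiseCoeffDeriv_le (hN : N ≠ 0) {u v : ℝ} (hu : 0 < u) (hv : v < 1)
    (s : Site N K) : ∃ B, ∀ t ∈ Ioo u v, |noiseCoeffDeriv β x t s| ≤ B := by
  have hcoupling : ∀ t ∈ Icc u v, 2 * √(t / (2 * N)) ≠ 0 := fun t ht => by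
    have := hu.trans_le ht.1
    positivity
  have hfield : ∀ t ∈ Icc u v, 2 * √(1 - t) ≠ 0 := fun t ht => by
    have := sub_pos.2 (ht.2.trans_lt hv)
    positivity
  apply exists_abs_le_of_continuousOn_Icc
  rcases s with p | p | i <;> simp only [noiseCoeffDeriv]
  · exact continuousOn_const.mul (continuousOn_const.div (by fun_prop) hcoupling)
  · exact (continuousOn_const.mul (continuousOn_const.div (by fun_prop) hfield)).mul
      continuousOn_const
  · exact continuousOn_const

lemma linearEnergy_le {ι : Type*} {T : Finset ι} {c : ι → ℝ} (hc : ∀ i ∈ T, 0 < c i) (a : ι → ℝ)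
    (F : ι → (ι → ℝ) → ℝ) (R : (ι → ℝ) → ℝ) (ω : ι → ℝ) : linearEnergy T a F R ω ≤
      ∑ i ∈ T, c i * ω i ^ 2 + (∑ i ∈ T, (a i * F i ω) ^ 2 / (4 * c i) + R ω) := by
  rw [linearEnergy, ← add_assoc, ← Finset.sum_add_distrib]
  gcongr with i hi
  have hci := hc i hi
  have hsq : c i * ω i ^ 2 + (a i * F i ω) ^ 2 / (4 * c i) - a i * (ω i * F i ω) =
      (2 * c i * ω i - a i * F i ω) ^ 2 / (4 * c i) := by
    field_simp
    ring
  exact sub_nonneg.1 (hsq ▸ by positivity)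

lemma sum_noiseCoeff_mul_spinProd_sq (ht : t ∈ Icc (0 : ℝ) 1) (z : Fin N → ℝ) :
    ∑ s ∈ noiseSites N K, (noiseCoeff β x t s * spinProd s z) ^ 2 / (4 * (cascade N x).c s) =
      t * β ^ 2 / (8 * N) * (∑ i, z i ^ 2) ^ 2 + 2 * β ^ 2 * (1 - t) * x.Q * ∑ i, z i ^ 2 := by
  have ht' := Real.sq_sqrt (sub_nonneg.2 ht.2)
  have htN := Real.sq_sqrt (show 0 ≤ t / (2 * N) from div_nonneg ht.1 (by positivity))
  have hq : ∀ a : Fin K, √(x.q a.succ - x.q a.castSucc) ^ 2 = x.q a.succ - x.q a.castSucc :=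
    fun a => Real.sq_sqrt (q_increment_nonneg x a)
  simp only [sum_noiseSites, noiseCoeff, spinProd, cascade, Sum.elim_inl, Sum.elim_inr, mul_pow,
    ht', htN, hq]
  rw [sq (∑ i, z i ^ 2), Finset.sum_mul_sum, ← sum_q_increments_univ x]
  simp only [Finset.sum_mul, Finset.mul_sum]
  congr 1
  · exact Finset.sum_congr rfl fun i _ => Finset.sum_congr rfl fun j _ => by ring
  · rw [Finset.sum_comm]
    refine Finset.sum_congr rfl fun i _ => Finset.sum_congr rfl fun a _ => by ring

lemma mul_sub_mul_sq_le {δ : ℝ} (hδ : 0 < δ) (D s : ℝ) : D * s - δ * s ^ 2 ≤ D ^ 2 / (4 * δ) := by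
  rw [le_div_iff₀ (by positivity)]
  linear_combination sq_nonneg (D - 2 * δ * s)

lemma magnetization_le (r : ℝ) (z : Fin N → ℝ) :
    r * ∑ i, z i ≤ N * r ^ 2 + ∑ i, z i ^ 2 := by
  have hconst : (N : ℝ) * r ^ 2 = ∑ _i : Fin N, r ^ 2 := by simp
  rw [hconst, ← Finset.sum_add_distrib, Finset.mul_sum]
  gcongr with i
  linear_combination sq_nonneg (r - z i) / 2 + (sq_nonneg r + sq_nonneg (z i)) / 2

lemma pureHam_le (hN : N ≠ 0) (hβ : β ≠ 0) {u : ℝ} (hu : 0 < u) (ht : t ∈ Ioo u 1)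
    (z : Fin N → ℝ) :
    t * β ^ 2 / (8 * N) * (∑ i, z i ^ 2) ^ 2 + 2 * β ^ 2 * (1 - t) * x.Q * ∑ i, z i ^ 2 +
      pureHam β h lam C t z ≤ N * (β * h) ^ 2 +
        (2 * β ^ 2 * x.Q + |C| + 1 + |lam|) ^ 2 / (4 * (β ^ 2 * u / (8 * N))) := by
  have hδ : 0 < β ^ 2 * u / (8 * N) := by positivity
  have ht0 : 0 < t := hu.trans ht.1
  have hQ : 0 ≤ x.Q := x.q_zero ▸ x.q_mono (Fin.zero_le _)
  have hs : 0 ≤ ∑ i, z i ^ 2 := Finset.sum_nonneg fun i _ => sq_nonneg _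
  have hquartic : β ^ 2 * u / (8 * N) * (∑ i, z i ^ 2) ^ 2 ≤
      β ^ 2 * t / (8 * N) * (∑ i, z i ^ 2) ^ 2 := by
    have := ht.1.le
    gcongr
  have hfield : (1 - t) * (2 * β ^ 2 * x.Q) ≤ 2 * β ^ 2 * x.Q :=
    mul_le_of_le_one_left (by positivity) (by linarith)
  have hC : (1 - t) * (C / 2) ≤ |C| := by
    nlinarith [le_abs_self C, abs_nonneg C, ht.2]
  have hlam : lam / 2 ≤ |lam| := by linarith [le_abs_self lam, abs_nonneg lam]
  have hquadratic := mul_le_mul_of_nonneg_right (add_le_add (add_le_add hfield hC) hlam) hs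
  have hmag := magnetization_le (β * h) z
  have hmax := mul_sub_mul_sq_le hδ (2 * β ^ 2 * x.Q + |C| + 1 + |lam|) (∑ i, z i ^ 2)
  have hsplit : t * (β ^ 2 / (4 * N)) * (∑ i, z i ^ 2) ^ 2 =
      2 * (β ^ 2 * t / (8 * N) * (∑ i, z i ^ 2) ^ 2) := by ring
  rw [pureHam, hsplit]
  linear_combination hquartic + hquadratic + hmag + hmax

lemma isEnergy_ham (hN : N ≠ 0) (hβ : β ≠ 0) {u v : ℝ} (hu : 0 < u) (hv : v < 1) :
    IsEnergy (cascade N x).c (Ioo u v) fun t => ham β h lam C x t := by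
  have hcpos : ∀ s, 0 < (cascade N x).c s := fun s => by
    rcases s with _ | s
    exacts [one_pos, by norm_num [cascade]]
  refine ⟨polyBdd_ham, N * (β * h) ^ 2 +
    (2 * β ^ 2 * x.Q + |C| + 1 + |lam|) ^ 2 / (4 * (β ^ 2 * u / (8 * N))), by positivity,
    fun t ht ω => (linearEnergy_le (fun s _ => hcpos s) _ _ _ ω).trans ?_⟩
  have ht1 : t < 1 := ht.2.trans hv
  rw [sum_noiseCoeff_mul_spinProd_sq ⟨(hu.trans ht.1).le, ht1.le⟩, add_comm]
  exact add_le_add (pureHam_le hN hβ hu ⟨ht.1, ht1⟩ (cfg ω))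
    (Finset.sum_le_sum_of_subset_of_nonneg (Finset.subset_univ _) fun s _ _ =>
      mul_nonneg (hcpos s).le (sq_nonneg _))

end Hamiltonian

section Transfer

variable {N K : ℕ} {β h lam C : ℝ} {x : StepOrderParameter K} {I : Set ℝ} {t : ℝ}

lemma cascade_m_succ (x : StepOrderParameter K) (b : Fin K) :
    (cascade N x).m (b + 1) = x.m b.succ.castSucc := cascade_m x b.succ.castSucc

lemma cascade_m_depth (x : StepOrderParameter K) : (cascade N x).m (K + 1) = 1 :=
  (cascade N x).m_depth

lemma lt_cascade_depth (x : StepOrderParameter K) (a : Fin (K + 1)) :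
    (a : ℕ) < (cascade N x).depth := a.2

lemma cascade_block_depth (x : StepOrderParameter K) :
    (cascade N x).block (K + 1) = (cascade N x).above K := by
  rw [← (cascade N x).block_union_above K]
  exact ((congrArg _ (cascade N x).above_depth).trans (union_empty _)).symm

lemma cascade_energy_depth (x : StepOrderParameter K) (H : (Site N K → ℝ) → ℝ) :
    (cascade N x).energy H (K + 1) = H := (cascade N x).energy_depth H

lemma measurable_boltzmannFactor (ξ : Noise N K) :
    Measurable (boltzmannFactor β h lam C x t ξ) := by
  unfold boltzmannFactor boltzmannExponent
  fun_prop

lemma boltzmannFactor_noise (ω : Site N K → ℝ) :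
    boltzmannFactor β h lam C x t (noise ω) (cfg ω) = Real.exp (ham β h lam C x t ω) := by
  rw [boltzmannFactor, boltzmannExponent_noise]

lemma integral_gaussVec_noise {g : Noise N K → (Fin N → ℝ) → ℝ} (hg : ∀ ξ, Measurable (g ξ))
    (x : StepOrderParameter K) (ω : Site N K → ℝ) : ∫ z, g (noise ω) z ∂(gaussVec N) =
      avg γ ((cascade N x).above K) (fun η => g (noise η) (cfg η)) ω := by
  rw [← (measurePreserving_cfg (K := K)).map_eq,
    integral_map measurePreserving_cfg.measurable.aemeasurable (hg _).aestronglyMeasurable]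
  simp only [avg, noise_mix_above_last, cfg_mix_above_last]

lemma integrable_gaussVec {g : Noise N K → (Fin N → ℝ) → ℝ} (hg : ∀ ξ, Measurable (g ξ))
    (x : StepOrderParameter K)
    (hi : AvgIntegrable γ ((cascade N x).above K) fun η => g (noise η) (cfg η)) (ξ : Noise N K) :
    Integrable (g ξ) (gaussVec N) := by
  refine (measurePreserving_cfg (K := K).integrable_comp (hg ξ).aestronglyMeasurable).1 ?_
  simpa only [noise_mix_above_last, cfg_mix_above_last, noise_liftNoise, Function.comp_def] using
    hi (liftNoise ξ)

lemma levelZ_last : levelZ (N := N) β h lam C x t (Fin.last K) = interpZ β h lam C x t := by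
  simp [levelZ]

lemma levelZ_castSucc (b : Fin K) (ξ : Noise N K) : levelZ β h lam C x t b.castSucc ξ =
    if x.m b.succ.castSucc = 0 then
      Real.exp (levelAvg b (fun η => Real.log (levelZ β h lam C x t b.succ η)) ξ)
    else (levelAvg b (fun η => levelZ β h lam C x t b.succ η ^ x.m b.succ.castSucc) ξ) ^
      (1 / x.m b.succ.castSucc) := by
  simp [levelZ]

lemma interpZ_noise (hH : IsEnergy (cascade N x).c I fun t => ham β h lam C x t) (ht : t ∈ I)
    (ω : Site N K → ℝ) :
    interpZ β h lam C x t (noise ω) = Real.exp ((cascade N x).energy (ham β h lam C x t) K ω) := by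
  have hexp := Cascade.exp_mul_energy hH ht (lt_cascade_depth x (Fin.last K)) ω
  simp only [Fin.val_last, cascade_m_depth, one_mul, cascade_energy_depth,
    cascade_block_depth] at hexp
  rw [hexp, interpZ, integral_gaussVec_noise measurable_boltzmannFactor x]
  simp only [boltzmannFactor_noise]

lemma levelZ_noise (hH : IsEnergy (cascade N x).c I fun t => ham β h lam C x t) (ht : t ∈ I)
    (a : Fin (K + 1)) (ω : Site N K → ℝ) :
    levelZ β h lam C x t a (noise ω) =
      Real.exp ((cascade N x).energy (ham β h lam C x t) a ω) := by
  induction a using Fin.reverseInduction generalizing ω with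
  | last => rw [levelZ_last, interpZ_noise hH ht, Fin.val_last]
  | cast b ih =>
    have hb := lt_cascade_depth (N := N) x b.castSucc
    have hm := (Cascade.isEnergy_energy hH (a := b + 1) hb).measurable t ht
    rw [levelZ_castSucc, ← cascade_m_succ (N := N)]
    rw [Fin.val_succ] at ih
    rw [Fin.val_castSucc] at hb ⊢
    split_ifs with h0
    · rw [levelAvg_noise x (measurable_of_comp_noise (by simpa only [ih, Real.log_exp] using hm)),
        Cascade.energy_of_lt _ _ hb, h0, logAvg_zero]
      simp only [ih, Real.log_exp]
    · rw [levelAvg_noise x (measurable_of_comp_noise (by simp only [ih, ← Real.exp_mul]; fun_prop))]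
      simp only [ih, ← Real.exp_mul, mul_comm _ ((cascade N x).m (b + 1))]
      rw [← Cascade.exp_mul_energy hH ht hb, ← Real.exp_mul]
      congr 1
      field_simp

lemma measurable_levelZ (hH : IsEnergy (cascade N x).c I fun t => ham β h lam C x t) (ht : t ∈ I)
    (a : Fin (K + 1)) : Measurable (levelZ (N := N) β h lam C x t a) := by
  have hm := (Cascade.isEnergy_energy hH (lt_cascade_depth x a).le).measurable t ht
  exact measurable_of_comp_noise (by simp only [levelZ_noise hH ht]; fun_prop)

lemma levelZ_succ_rpow_noise (hH : IsEnergy (cascade N x).c I fun t => ham β h lam C x t)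
    (ht : t ∈ I) (a : Fin K) (ω : Site N K → ℝ) :
    levelZ β h lam C x t a.succ (noise ω) ^ x.m a.succ.castSucc =
      Real.exp ((cascade N x).m (a + 1) *
        (cascade N x).energy (ham β h lam C x t) (a + 1) ω) := by
  rw [levelZ_noise hH ht, ← Real.exp_mul, ← cascade_m_succ (N := N), mul_comm, Fin.val_succ]

lemma levelWeight_noise (hH : IsEnergy (cascade N x).c I fun t => ham β h lam C x t) (ht : t ∈ I)
    (a : Fin K) (ω : Site N K → ℝ) :
    levelWeight β h lam C x t a (noise ω) = (cascade N x).weight (ham β h lam C x t) a ω := by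
  have ha : (a : ℕ) < (cascade N x).depth := lt_cascade_depth x a.castSucc
  rw [levelWeight, levelAvg_noise x ((measurable_levelZ hH ht a.succ).pow_const _)]
  simp only [levelZ_succ_rpow_noise hH ht]
  rw [← Cascade.exp_mul_energy hH ht ha, ← Real.exp_sub, Cascade.weight, mul_sub]

@[to_additive]
lemma prod_filter_fin {M : Type*} [CommMonoid M] (n : ℕ) (p : ℕ → Prop) [DecidablePred p]
    (f : ℕ → M) : ∏ b : Fin n with p b.val, f b = ∏ j ∈ Finset.range n with p j, f j := by
  rw [Finset.prod_filter, Finset.prod_filter, ← Fin.prod_univ_eq_prod_range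
    (fun j => if p j then f j else 1)]

lemma headWeight_noise (hH : IsEnergy (cascade N x).c I fun t => ham β h lam C x t) (ht : t ∈ I)
    (a : Fin (K + 1)) (ω : Site N K → ℝ) :
    headWeight β h lam C x t a (noise ω) = (cascade N x).density (ham β h lam C x t) 0 a ω := by
  simp only [headWeight, levelWeight_noise hH ht, Cascade.density, Fin.lt_def, Fin.val_castSucc]
  rw [prod_filter_fin K (· < a) fun j => (cascade N x).weight (ham β h lam C x t) j ω]
  congr 1
  ext j
  simp only [Finset.mem_filter, Finset.mem_range, Finset.mem_Ico]
  omega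

lemma tailWeight_noise (hH : IsEnergy (cascade N x).c I fun t => ham β h lam C x t) (ht : t ∈ I)
    (a : Fin (K + 1)) (ω : Site N K → ℝ) :
    tailWeight β h lam C x t a (noise ω) = (cascade N x).density (ham β h lam C x t) a K ω := by
  simp only [tailWeight, levelWeight_noise hH ht, Cascade.density, Fin.le_def, Fin.val_castSucc]
  rw [prod_filter_fin K (a ≤ ·) fun j => (cascade N x).weight (ham β h lam C x t) j ω]
  congr 1
  ext j
  simp only [Finset.mem_filter, Finset.mem_range, Finset.mem_Ico]
  omega

lemma measurable_of_comp_cfg {O : (Fin N → ℝ) → ℝ}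
    (hO : Measurable fun ω : Site N K → ℝ => O (cfg ω)) : Measurable O := by
  have hlift : Measurable fun z : Fin N → ℝ => (Sum.elim 0 (Sum.elim 0 z) : Site N K → ℝ) := by
    refine measurable_pi_lambda _ fun s => ?_
    rcases s with p | p | i <;> simp only [Sum.elim_inl, Sum.elim_inr] <;> fun_prop
  exact hO.comp hlift

variable {O : (Fin N → ℝ) → ℝ}

lemma gibbs_noise (hH : IsEnergy (cascade N x).c I fun t => ham β h lam C x t) (ht : t ∈ I)
    (hO : PolyBdd I fun _ (ω : Site N K → ℝ) => O (cfg ω)) (ω : Site N K → ℝ) :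
    gibbs β h lam C x t O (noise ω) =
      (cascade N x).state (ham β h lam C x t) K (fun η => O (cfg η)) ω := by
  have hK := lt_cascade_depth (N := N) x (Fin.last K)
  have hm : ∀ ξ, Measurable fun z => O z * boltzmannFactor β h lam C x t ξ z := fun ξ =>
    (measurable_of_comp_cfg (hO.measurable t ht)).mul (measurable_boltzmannFactor ξ)
  have hstate : (cascade N x).state (ham β h lam C x t) (K + 1) (fun η => O (cfg η)) =
      fun η => O (cfg η) := (cascade N x).state_depth _ _
  rw [Fin.val_last] at hK
  rw [gibbs, interpZ_noise hH ht, integral_gaussVec_noise hm x, Cascade.state_of_lt _ _ _ hK,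
    Cascade.energy_of_lt _ _ hK, tilt_eq, cascade_m_depth, cascade_energy_depth, hstate,
    cascade_block_depth, Real.exp_neg]
  simp only [boltzmannFactor_noise, one_mul, mul_comm (O _)]

lemma levelState_noise (hH : IsEnergy (cascade N x).c I fun t => ham β h lam C x t) (ht : t ∈ I)
    (hO : PolyBdd I fun _ (ω : Site N K → ℝ) => O (cfg ω)) (a : Fin (K + 1)) (ω : Site N K → ℝ) :
    levelState β h lam C x t a O (noise ω) =
      (cascade N x).state (ham β h lam C x t) a (fun η => O (cfg η)) ω := by
  have hK := (lt_cascade_depth (N := N) x (Fin.last K)).le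
  have hweight : ∀ ω : Site N K → ℝ, tailWeight β h lam C x t a (noise ω) *
      gibbs β h lam C x t O (noise ω) = (cascade N x).density (ham β h lam C x t) a K ω *
        (cascade N x).state (ham β h lam C x t) K (fun η => O (cfg η)) ω := fun ω => by
    rw [tailWeight_noise hH ht, gibbs_noise hH ht hO]
  have hm : Measurable fun ξ => tailWeight β h lam C x t a ξ * gibbs β h lam C x t O ξ := by
    refine measurable_of_comp_noise ?_
    simp only [hweight]
    exact (Cascade.measurable_density hH ht a hK).mul
      ((Cascade.polyBdd_state hH hO hK).measurable t ht)
  rw [levelState, tailAvg_noise x hm]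
  simp only [hweight]
  exact congrFun (Cascade.avg_density_mul_state_sdiff hH hO ht (Nat.lt_succ_iff.1 a.2) hK) ω

end Transfer

section Replicas

variable {N K : ℕ} {β h lam C : ℝ} {x : StepOrderParameter K} {I : Set ℝ} {t : ℝ}

lemma integrable_boltzmannFactor (hH : IsEnergy (cascade N x).c I fun t => ham β h lam C x t)
    (ht : t ∈ I) (ξ : Noise N K) : Integrable (boltzmannFactor β h lam C x t ξ) (gaussVec N) := by
  refine integrable_gaussVec measurable_boltzmannFactor x ?_ ξ
  have hexp := ((cascade N x).isStep_block K).avgIntegrable_exp hH ht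
  simpa only [boltzmannFactor_noise, cascade_block_depth, cascade_m_depth, one_mul] using hexp

lemma log_levelZ_noise (hH : IsEnergy (cascade N x).c I fun t => ham β h lam C x t) (ht : t ∈ I)
    (a : Fin (K + 1)) (ω : Site N K → ℝ) : Real.log (levelZ β h lam C x t a (noise ω)) =
      (cascade N x).energy (ham β h lam C x t) a ω := by
  rw [levelZ_noise hH ht, Real.log_exp]

lemma phiConverges (hH : IsEnergy (cascade N x).c I fun t => ham β h lam C x t) (ht : t ∈ I) :
    PhiConverges N β h lam C x t := by
  have hZ := measurable_levelZ hH ht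
  have henergy := fun a : Fin (K + 1) => Cascade.isEnergy_energy hH (lt_cascade_depth x a).le
  refine ⟨integrable_boltzmannFactor hH ht, fun a ξ => ⟨?_, ?_⟩, ?_⟩
  · refine integrable_levelAvg x ((hZ a.succ).pow_const _) a ?_ ξ
    simpa only [levelZ_succ_rpow_noise hH ht, Fin.val_succ] using
      ((cascade N x).isStep_block a).avgIntegrable_exp (henergy a.succ) ht
  · refine integrable_levelAvg x (hZ a.succ).log a ?_ ξ
    simpa only [log_levelZ_noise hH ht] using
      (henergy a.succ).avgIntegrable _ ht
  · rw [integrable_noiseLaw_iff (hZ 0).log]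
    simpa only [log_levelZ_noise hH ht] using
      ((henergy 0).avgIntegrable univ ht).integrable

lemma interpPhi_eq (hH : IsEnergy (cascade N x).c I fun t => ham β h lam C x t) (ht : t ∈ I) :
    interpPhi N β h lam C x t = 1 / N *
      ∫ ω, (cascade N x).energy (ham β h lam C x t) 0 ω ∂(stdGauss (Site N K)) := by
  rw [interpPhi, integral_noiseLaw (measurable_levelZ hH ht 0).log]
  simp only [log_levelZ_noise hH ht, Fin.val_zero]

variable {κ : Type*} [Fintype κ] {f g : κ → (Fin N → ℝ) → ℝ}

lemma levelState_sum_noise (hH : IsEnergy (cascade N x).c I fun t => ham β h lam C x t)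
    (ht : t ∈ I) (hf : ∀ k, PolyBdd I fun _ (ω : Site N K → ℝ) => f k (cfg ω))
    (a : Fin (K + 1)) (r : κ → ℝ) (ω : Site N K → ℝ) :
    levelState β h lam C x t a (fun z => ∑ k, r k * f k z) (noise ω) =
      ∑ k, r k * (cascade N x).state (ham β h lam C x t) a (fun η => f k (cfg η)) ω := by
  have ha := (lt_cascade_depth (N := N) x a).le
  have hterm := fun k => (hf k).const_mul (r k)
  have hsum : PolyBdd I fun _ (ω : Site N K → ℝ) => ∑ k, r k * f k (cfg ω) :=
    PolyBdd.sum _ fun k _ => hterm k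
  rw [levelState_noise (O := fun z => ∑ k, r k * f k z) hH ht hsum,
    Cascade.state_sum _ hH (fun k _ => hterm k) ht ha]
  simp only [Cascade.state_const_mul _ _ _ ha]

lemma levelState₂_noise (hH : IsEnergy (cascade N x).c I fun t => ham β h lam C x t) (ht : t ∈ I)
    (hf : ∀ k, PolyBdd I fun _ (ω : Site N K → ℝ) => f k (cfg ω))
    (hg : ∀ k, PolyBdd I fun _ (ω : Site N K → ℝ) => g k (cfg ω)) (a : Fin (K + 1)) (r : κ → ℝ)
    (ω : Site N K → ℝ) :
    levelState₂ β h lam C x t a (fun z₁ z₂ => ∑ k, r k * (f k z₁ * g k z₂)) (noise ω) =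
      ∑ k, r k * ((cascade N x).state (ham β h lam C x t) a (fun η => f k (cfg η)) ω *
        (cascade N x).state (ham β h lam C x t) a (fun η => g k (cfg η)) ω) := by
  simp only [levelState₂, ← mul_assoc, levelState_sum_noise hH ht hg]
  simp only [mul_right_comm (r _) (f _ _)]
  rw [levelState_sum_noise hH ht hf]
  exact Finset.sum_congr rfl fun k _ => mul_right_comm _ _ _

lemma headWeight_mul_levelState₂_noise
    (hH : IsEnergy (cascade N x).c I fun t => ham β h lam C x t) (ht : t ∈ I)
    (hf : ∀ k, PolyBdd I fun _ (ω : Site N K → ℝ) => f k (cfg ω))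
    (hg : ∀ k, PolyBdd I fun _ (ω : Site N K → ℝ) => g k (cfg ω)) (a : Fin (K + 1)) (r : κ → ℝ)
    (ω : Site N K → ℝ) : headWeight β h lam C x t a (noise ω) *
        levelState₂ β h lam C x t a (fun z₁ z₂ => ∑ k, r k * (f k z₁ * g k z₂)) (noise ω) =
      ∑ k, r k * ((cascade N x).density (ham β h lam C x t) 0 a ω *
        ((cascade N x).state (ham β h lam C x t) a (fun η => f k (cfg η)) ω *
          (cascade N x).state (ham β h lam C x t) a (fun η => g k (cfg η)) ω)) := by
  rw [headWeight_noise hH ht, levelState₂_noise hH ht hf hg, Finset.mul_sum]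
  exact Finset.sum_congr rfl fun k _ => mul_left_comm _ _ _

lemma measurable_headWeight_mul_levelState₂
    (hH : IsEnergy (cascade N x).c I fun t => ham β h lam C x t) (ht : t ∈ I)
    (hf : ∀ k, PolyBdd I fun _ (ω : Site N K → ℝ) => f k (cfg ω))
    (hg : ∀ k, PolyBdd I fun _ (ω : Site N K → ℝ) => g k (cfg ω)) (a : Fin (K + 1)) (r : κ → ℝ) :
    Measurable fun ξ => headWeight β h lam C x t a ξ *
      levelState₂ β h lam C x t a (fun z₁ z₂ => ∑ k, r k * (f k z₁ * g k z₂)) ξ := by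
  have ha := (lt_cascade_depth (N := N) x a).le
  refine measurable_of_comp_noise ?_
  simp only [headWeight_mul_levelState₂_noise hH ht hf hg]
  exact Finset.measurable_fun_sum _ fun k _ => ((Cascade.measurable_density hH ht 0 ha).mul
    (((Cascade.polyBdd_state hH (hf k) ha).measurable t ht).mul
      ((Cascade.polyBdd_state hH (hg k) ha).measurable t ht))).const_mul _

lemma integrable_headWeight_mul_levelState₂
    (hH : IsEnergy (cascade N x).c I fun t => ham β h lam C x t) (ht : t ∈ I)
    (hf : ∀ k, PolyBdd I fun _ (ω : Site N K → ℝ) => f k (cfg ω))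
    (hg : ∀ k, PolyBdd I fun _ (ω : Site N K → ℝ) => g k (cfg ω)) (a : Fin (K + 1)) (r : κ → ℝ) :
    Integrable (fun ξ => headWeight β h lam C x t a ξ *
      levelState₂ β h lam C x t a (fun z₁ z₂ => ∑ k, r k * (f k z₁ * g k z₂)) ξ)
      (noiseLaw N K) := by
  rw [integrable_noiseLaw_iff (measurable_headWeight_mul_levelState₂ hH ht hf hg a r)]
  simp only [headWeight_mul_levelState₂_noise hH ht hf hg]
  exact integrable_finsetSum _ fun k _ => (Cascade.integrable_replica hH (hf k) (hg k) ht
    (lt_cascade_depth x a).le).const_mul _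

lemma bracket_sum (hH : IsEnergy (cascade N x).c I fun t => ham β h lam C x t) (ht : t ∈ I)
    (hf : ∀ k, PolyBdd I fun _ (ω : Site N K → ℝ) => f k (cfg ω))
    (hg : ∀ k, PolyBdd I fun _ (ω : Site N K → ℝ) => g k (cfg ω)) (a : Fin (K + 1)) (r : κ → ℝ) :
    bracket β h lam C x t a (fun z₁ z₂ => ∑ k, r k * (f k z₁ * g k z₂)) =
      ∑ k, r k * (cascade N x).replica (ham β h lam C x t) a (fun ω => f k (cfg ω))
        (fun ω => g k (cfg ω)) := by
  rw [bracket, integral_noiseLaw (measurable_headWeight_mul_levelState₂ hH ht hf hg a r)]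
  simp only [headWeight_mul_levelState₂_noise hH ht hf hg]
  rw [integral_finsetSum _ fun k _ => (Cascade.integrable_replica hH (hf k) (hg k) ht
    (lt_cascade_depth x a).le).const_mul _]
  simp only [integral_const_mul, Cascade.replica]

end Replicas

section Overlap

variable {N K : ℕ}

/-- The monomials in the spins which occur in the square of `overlap z₁ z₂ - r`. -/
def overlapMonomial : (Fin N × Fin N) ⊕ (Fin N ⊕ Unit) → (Fin N → ℝ) → ℝ
  | .inl p, z => z p.1 * z p.2
  | .inr (.inl i), z => z i
  | .inr (.inr _), _ => 1

/-- The coefficients of the monomials `overlapMonomial k z₁ * overlapMonomial k z₂` in the square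
of `overlap z₁ z₂ - r`. -/
def overlapCoeff (N : ℕ) (r : ℝ) : (Fin N × Fin N) ⊕ (Fin N ⊕ Unit) → ℝ
  | .inl _ => 1 / (N : ℝ) ^ 2
  | .inr (.inl _) => -(2 * r / N)
  | .inr (.inr _) => r ^ 2

lemma overlap_sub_sq (z₁ z₂ : Fin N → ℝ) (r : ℝ) : (overlap z₁ z₂ - r) ^ 2 =
    ∑ k, overlapCoeff N r k * (overlapMonomial k z₁ * overlapMonomial k z₂) := by
  have hsq : ∑ p : Fin N × Fin N, z₁ p.1 * z₁ p.2 * (z₂ p.1 * z₂ p.2) =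
      (∑ i, z₁ i * z₂ i) ^ 2 := by
    rw [sq, Finset.sum_mul_sum, Fintype.sum_prod_type]
    simp only [mul_mul_mul_comm]
  simp only [Fintype.sum_sum_type, overlapCoeff, overlapMonomial, ← Finset.mul_sum, hsq, overlap,
    Finset.univ_unique, Finset.sum_singleton]
  ring

variable {I : Set ℝ}

lemma polyBdd_overlapMonomial (k : (Fin N × Fin N) ⊕ (Fin N ⊕ Unit)) :
    PolyBdd I fun _ (ω : Site N K → ℝ) => overlapMonomial k (cfg ω) := by
  rcases k with p | i | _
  exacts [(polyBdd_cfg _).mul (polyBdd_cfg _), polyBdd_cfg _, polyBdd_const 1]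

variable (β h lam C : ℝ) (x : StepOrderParameter K) (t : ℝ)

/-- The average of the overlap `N q₁₂` over two replicas which share the variables up to the
level `b`; for `b = K + 1` they coincide. -/
def overlapMean (N : ℕ) (b : ℕ) : ℝ :=
  ∑ i, (cascade N x).replica (ham β h lam C x t) b (fun ω => cfg ω i) (fun ω => cfg ω i)

/-- The average of the squared overlap `(N q₁₂) ^ 2` over two replicas which share the variables
up to the level `b`; for `b = K + 1` they coincide. -/
def overlapSqMean (N : ℕ) (b : ℕ) : ℝ :=
  ∑ i, ∑ j, (cascade N x).replica (ham β h lam C x t) b (fun ω => cfg ω i * cfg ω j)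
    (fun ω => cfg ω i * cfg ω j)

variable {β h lam C x t}

lemma replica_one_one (hH : IsEnergy (cascade N x).c I fun t => ham β h lam C x t) (ht : t ∈ I)
    (a : Fin (K + 1)) :
    (cascade N x).replica (ham β h lam C x t) a (fun _ => 1) (fun _ => 1) = 1 := by
  have hone : PolyBdd I fun _ (_ : Site N K → ℝ) => (1 : ℝ) := polyBdd_const 1
  rw [Cascade.replica_one_right hH hone ht (lt_cascade_depth x a).le,
    Cascade.integral_density_mul hH hone ht, Cascade.state_one hH ht (Nat.zero_le _)]
  simp

lemma bracket_overlap_sub_sq (hH : IsEnergy (cascade N x).c I fun t => ham β h lam C x t)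
    (ht : t ∈ I) (a : Fin (K + 1)) (r : ℝ) :
    bracket β h lam C x t a (fun z₁ z₂ : Fin N → ℝ => (overlap z₁ z₂ - r) ^ 2) =
      1 / (N : ℝ) ^ 2 * overlapSqMean β h lam C x t N a -
        2 * r / N * overlapMean β h lam C x t N a + r ^ 2 := by
  simp only [overlap_sub_sq]
  rw [bracket_sum hH ht polyBdd_overlapMonomial polyBdd_overlapMonomial]
  simp only [Fintype.sum_sum_type, Fintype.sum_prod_type, overlapCoeff, overlapMonomial,
    ← Finset.mul_sum, overlapSqMean, overlapMean, Finset.univ_unique, Finset.sum_singleton,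
    replica_one_one hH ht]
  ring

lemma integrable_overlap_sub_sq (hH : IsEnergy (cascade N x).c I fun t => ham β h lam C x t)
    (ht : t ∈ I) (a : Fin (K + 1)) (r : ℝ) :
    Integrable (fun ξ => headWeight β h lam C x t a ξ *
      levelState₂ β h lam C x t a (fun z₁ z₂ => (overlap z₁ z₂ - r) ^ 2) ξ) (noiseLaw N K) := by
  simp only [overlap_sub_sq]
  exact integrable_headWeight_mul_levelState₂ hH ht polyBdd_overlapMonomial
    polyBdd_overlapMonomial a _

lemma overlapMean_depth (hH : IsEnergy (cascade N x).c I fun t => ham β h lam C x t)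
    (ht : t ∈ I) : overlapMean β h lam C x t N (cascade N x).depth =
      ∫ ω, (cascade N x).density (ham β h lam C x t) 0 (cascade N x).depth ω * ∑ i, cfg ω i ^ 2
        ∂(stdGauss (Site N K)) := by
  have hsq := fun i : Fin N => (polyBdd_cfg (K := K) (I := I) i).mul (polyBdd_cfg i)
  simp only [overlapMean, Cascade.replica_depth, Finset.mul_sum, sq]
  rw [integral_finsetSum _ fun i _ => Cascade.integrable_density_mul hH (hsq i) ht]

lemma overlapSqMean_depth (hH : IsEnergy (cascade N x).c I fun t => ham β h lam C x t)
    (ht : t ∈ I) : overlapSqMean β h lam C x t N (cascade N x).depth =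
      ∫ ω, (cascade N x).density (ham β h lam C x t) 0 (cascade N x).depth ω *
        (∑ i, cfg ω i ^ 2) ^ 2 ∂(stdGauss (Site N K)) := by
  have hsq : ∀ z : Fin N → ℝ, (∑ i, z i ^ 2) ^ 2 =
      ∑ p : Fin N × Fin N, z p.1 * z p.2 * (z p.1 * z p.2) := fun z => by
    rw [sq, Finset.sum_mul_sum, Fintype.sum_prod_type]
    simp only [sq, mul_mul_mul_comm]
  have hpair := fun p : Fin N × Fin N =>
    (polyBdd_cfg (K := K) (I := I) p.1).mul (polyBdd_cfg p.2)
  simp only [overlapSqMean, ← Fintype.sum_prod_type', Cascade.replica_depth, hsq, Finset.mul_sum]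
  rw [integral_finsetSum _ fun p _ =>
    Cascade.integrable_density_mul hH ((hpair p).mul (hpair p)) ht]

lemma bracket_last_overlap_self (hH : IsEnergy (cascade N x).c I fun t => ham β h lam C x t)
    (ht : t ∈ I) : bracket β h lam C x t (Fin.last K) (fun z _ : Fin N → ℝ => overlap z z) =
      1 / N * overlapMean β h lam C x t N (cascade N x).depth := by
  have hsq := fun i : Fin N => (polyBdd_cfg (K := K) (I := I) i).mul (polyBdd_cfg i)
  have hone : Fin N → PolyBdd I fun _ (_ : Site N K → ℝ) => (1 : ℝ) := fun _ => polyBdd_const 1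
  have hsum := bracket_sum hH ht (f := fun i z => z i * z i) (g := fun _ _ => 1) hsq hone
    (Fin.last K) fun _ => 1 / (N : ℝ)
  simp only [← Finset.mul_sum, mul_one] at hsum
  simp only [overlap, hsum, overlapMean, Cascade.replica_depth]
  congr 1
  exact Finset.sum_congr rfl fun i _ =>
    Cascade.replica_one_right hH (hsq i) ht (lt_cascade_depth x (Fin.last K)).le

end Overlap

section Derivative

variable {N K : ℕ} {β h lam C : ℝ} {x : StepOrderParameter K} {I : Set ℝ} {t : ℝ}

lemma replicaCov_eq (H F G : (Site N K → ℝ) → ℝ) (l : ℕ) :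
    (cascade N x).replicaCov H l F G = (cascade N x).replica H (cascade N x).depth F G -
      ∑ b : Fin (K + 1) with l ≤ b.val, (x.m b.succ - x.m b.castSucc) *
        (cascade N x).replica H b F G := by
  have hIco : Finset.Ico l (cascade N x).depth = (Finset.range (K + 1)).filter (l ≤ ·) := by
    ext b
    simp only [Finset.mem_Ico, Finset.mem_filter, Finset.mem_range, cascade, and_comm]
  rw [Cascade.replicaCov, hIco, ← sum_filter_fin (K + 1) (l ≤ ·) fun b =>
    ((cascade N x).m (b + 1) - (cascade N x).m b) * (cascade N x).replica H b F G]
  simp only [← cascade_m (N := N), Fin.val_succ, Fin.val_castSucc]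

lemma sum_replicaCov_coupling : ∑ i, ∑ j, (cascade N x).replicaCov (ham β h lam C x t) 0
      (fun ω => cfg ω i * cfg ω j) (fun ω => cfg ω i * cfg ω j) =
    overlapSqMean β h lam C x t N (cascade N x).depth -
      ∑ b : Fin (K + 1), (x.m b.succ - x.m b.castSucc) * overlapSqMean β h lam C x t N b := by
  simp only [replicaCov_eq, Nat.zero_le, Finset.filter_true, Finset.sum_sub_distrib,
    overlapSqMean, Finset.mul_sum]
  congr 1
  exact (Finset.sum_congr rfl fun i _ => Finset.sum_comm).trans Finset.sum_comm

lemma sum_replicaCov_field : ∑ a : Fin K, (x.q a.succ - x.q a.castSucc) *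
      ∑ i, (cascade N x).replicaCov (ham β h lam C x t) (a + 1) (fun ω => cfg ω i)
        (fun ω => cfg ω i) =
    x.Q * overlapMean β h lam C x t N (cascade N x).depth -
      ∑ b : Fin (K + 1),
        (x.m b.succ - x.m b.castSucc) * (x.q b * overlapMean β h lam C x t N b) := by
  have hlevel : ∀ a : Fin K, ∑ i, (cascade N x).replicaCov (ham β h lam C x t) (a + 1)
      (fun ω => cfg ω i) (fun ω => cfg ω i) = overlapMean β h lam C x t N (cascade N x).depth -
        ∑ b : Fin (K + 1) with a.castSucc < b,
          (x.m b.succ - x.m b.castSucc) * overlapMean β h lam C x t N b := fun a => by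
    simp only [replicaCov_eq, Finset.sum_sub_distrib, overlapMean, Finset.mul_sum, Fin.lt_def,
      Fin.val_castSucc, Nat.succ_le_iff]
    rw [Finset.sum_comm]
  have hq : ∀ b : Fin (K + 1),
      (x.m b.succ - x.m b.castSucc) * (x.q b * overlapMean β h lam C x t N b) =
        ∑ a : Fin K with a.castSucc < b, (x.q a.succ - x.q a.castSucc) *
          ((x.m b.succ - x.m b.castSucc) * overlapMean β h lam C x t N b) := fun b => by
    rw [← Finset.sum_mul, sum_q_increments, mul_left_comm]
  simp only [hlevel, mul_sub]
  rw [Finset.sum_sub_distrib, ← Finset.sum_mul, sum_q_increments_univ]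
  simp only [hq, Finset.mul_sum, Finset.sum_filter, mul_ite, mul_zero]
  rw [Finset.sum_comm]

lemma sum_noiseCoeff_mul_replicaCov (hN : N ≠ 0) (ht : t ∈ Ioo (0 : ℝ) 1)
    (H : (Site N K → ℝ) → ℝ) :
    ∑ s ∈ noiseSites N K, noiseCoeff β x t s * noiseCoeffDeriv β x t s *
        (cascade N x).replicaCov H ((cascade N x).level s) (fun ω => spinProd s (cfg ω))
          (fun ω => spinProd s (cfg ω)) =
      β ^ 2 / (4 * N) * ∑ i, ∑ j, (cascade N x).replicaCov H 0 (fun ω => cfg ω i * cfg ω j)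
          (fun ω => cfg ω i * cfg ω j) -
        β ^ 2 / 2 * ∑ a : Fin K, (x.q a.succ - x.q a.castSucc) *
          ∑ i, (cascade N x).replicaCov H (a + 1) (fun ω => cfg ω i) (fun ω => cfg ω i) := by
  simp only [sum_noiseSites, noiseCoeff_mul_noiseCoeffDeriv_inl hN ht.1,
    noiseCoeff_mul_noiseCoeffDeriv_inr_inl ht.2]
  simp only [neg_mul, Finset.sum_neg_distrib, mul_assoc, ← Finset.mul_sum]
  rfl

lemma integral_density_mul_pureHamDeriv
    (hH : IsEnergy (cascade N x).c I fun t => ham β h lam C x t) (ht : t ∈ I) :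
    ∫ ω, (cascade N x).density (ham β h lam C x t) 0 (cascade N x).depth ω *
        pureHamDeriv β C (cfg ω) ∂(stdGauss (Site N K)) =
      -(β ^ 2 / (4 * N) * overlapSqMean β h lam C x t N (cascade N x).depth) -
        C / 2 * overlapMean β h lam C x t N (cascade N x).depth := by
  have hquartic := (Cascade.integrable_density_mul hH (polyBdd_sum_cfg_sq.pow 2) ht).const_mul
    (-(β ^ 2 / (4 * (N : ℝ))))
  have hquadratic := (Cascade.integrable_density_mul hH polyBdd_sum_cfg_sq ht).const_mul (C / 2)
  rw [overlapMean_depth hH ht, overlapSqMean_depth hH ht, ← neg_mul, ← integral_const_mul,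
    ← integral_const_mul, ← integral_sub hquartic hquadratic]
  congr 1
  funext ω
  rw [pureHamDeriv]
  ring

lemma hasDerivAt_integral_energy_ham (hN : N ≠ 0) (hβ : β ≠ 0) {u v : ℝ} (hu : 0 < u)
    (hv : v < 1) (ht : t ∈ Ioo u v) :
    HasDerivAt (fun t => ∫ ω, (cascade N x).energy (ham β h lam C x t) 0 ω ∂(stdGauss (Site N K)))
      (∑ b : Fin (K + 1), (x.m b.succ - x.m b.castSucc) * (β ^ 2 / 2 *
          (x.q b * overlapMean β h lam C x t N b) -
            β ^ 2 / (4 * N) * overlapSqMean β h lam C x t N b) -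
        (C + β ^ 2 * x.Q) / 2 * overlapMean β h lam C x t N (cascade N x).depth) t := by
  have hH : IsEnergy (cascade N x).c (Ioo u v) fun t => ham β h lam C x t :=
    isEnergy_ham hN hβ hu hv
  have h01 : Ioo u v ⊆ Ioo 0 1 := Ioo_subset_Ioo hu.le hv.le
  refine (Cascade.hasDerivAt_integral_energy_linearEnergy isOpen_Ioo hH
    (fun s _ => polyBdd_spinProd s) polyBdd_pureHamDeriv (fun s _ => dependsOn_comp_cfg _)
    (fun t _ => dependsOn_comp_cfg _) (fun s _ t ht => hasDerivAt_noiseCoeff hN (h01 ht) s)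
    (fun s _ => exists_abs_noiseCoeffDeriv_le hN hu hv s)
    (fun t _ ω => hasDerivAt_pureHam t (cfg ω)) ht).congr_deriv ?_
  have hsplit : ∑ b : Fin (K + 1), (x.m b.succ - x.m b.castSucc) * (β ^ 2 / 2 *
        (x.q b * overlapMean β h lam C x t N b) -
          β ^ 2 / (4 * N) * overlapSqMean β h lam C x t N b) =
      β ^ 2 / 2 * ∑ b : Fin (K + 1),
          (x.m b.succ - x.m b.castSucc) * (x.q b * overlapMean β h lam C x t N b) -
        β ^ 2 / (4 * N) * ∑ b : Fin (K + 1),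
          (x.m b.succ - x.m b.castSucc) * overlapSqMean β h lam C x t N b := by
    simp only [mul_sub, Finset.sum_sub_distrib, Finset.mul_sum, mul_left_comm (β ^ 2 / _)]
  refine (congrArg₂ (· + ·) (sum_noiseCoeff_mul_replicaCov hN (h01 ht) _)
    (integral_density_mul_pureHamDeriv hH ht)).trans ?_
  have hcoupling := sum_replicaCov_coupling (N := N) (β := β) (h := h) (lam := lam) (C := C)
    (x := x) (t := t)
  have hfield := sum_replicaCov_field (N := N) (β := β) (h := h) (lam := lam) (C := C)
    (x := x) (t := t)
  simp only [ham] at hcoupling hfield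
  rw [hsplit, hcoupling, hfield]
  ring

lemma hasDerivAt_interpPhi (hN : N ≠ 0) (hβ : β ≠ 0) {u v : ℝ} (hu : 0 < u) (hv : v < 1)
    (ht : t ∈ Ioo u v) :
    HasDerivAt (fun s => interpPhi N β h lam C x s)
      (β ^ 2 / 4 * ∑ a : Fin (K + 1), (x.m a.succ - x.m a.castSucc) * x.q a ^ 2 -
        β ^ 2 / 4 * ∑ a : Fin (K + 1), (x.m a.succ - x.m a.castSucc) *
          bracket (N := N) β h lam C x t a (fun z₁ z₂ => (overlap z₁ z₂ - x.q a) ^ 2) -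
        (C + β ^ 2 * x.Q) / 2 *
          bracket (N := N) β h lam C x t (Fin.last K) (fun z _ => overlap z z)) t := by
  have hH : IsEnergy (cascade N x).c (Ioo u v) fun t => ham β h lam C x t :=
    isEnergy_ham hN hβ hu hv
  refine (((hasDerivAt_integral_energy_ham hN hβ hu hv ht).const_mul
    (1 / (N : ℝ))).congr_of_eventuallyEq ((eventually_mem_nhds_iff.2 (Ioo_mem_nhds ht.1 ht.2)).mono
      fun s hs => interpPhi_eq hH (mem_of_mem_nhds hs))).congr_deriv ?_
  rw [bracket_last_overlap_self hH ht, mul_sub]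
  congr 1
  · simp only [bracket_overlap_sub_sq hH ht, Finset.mul_sum, ← Finset.sum_sub_distrib]
    exact Finset.sum_congr rfl fun b _ => by ring
  · ring

end Derivative

end GaussianSpinGlass

end

open GaussianSpinGlass in
theorem theorem6_general {N : ℕ} (hN : N ≠ 0) {K : ℕ} (x : StepOrderParameter K)
    {β : ℝ} (hβ : β ≠ 0) (h lam C : ℝ) {t : ℝ} (ht : t ∈ Set.Ioo (0 : ℝ) 1) :
    PhiConverges N β h lam C x t ∧
    (∀ a : Fin (K + 1), MeasureTheory.Integrable
      (fun ξ : Noise N K => headWeight β h lam C x t a ξ *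
        levelState₂ β h lam C x t a (fun z₁ z₂ => (overlap z₁ z₂ - x.q a) ^ 2) ξ)
      (noiseLaw N K)) ∧
    HasDerivAt (fun s : ℝ => interpPhi N β h lam C x s)
      (β ^ 2 / 4 * ∑ a : Fin (K + 1), (x.m a.succ - x.m a.castSucc) * x.q a ^ 2
        - β ^ 2 / 4 * ∑ a : Fin (K + 1), (x.m a.succ - x.m a.castSucc) *
            bracket (N := N) β h lam C x t a (fun z₁ z₂ => (overlap z₁ z₂ - x.q a) ^ 2)
        - (C + β ^ 2 * x.Q) / 2 *
            bracket (N := N) β h lam C x t (Fin.last K) (fun z _ => overlap z z))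
      t := by
  obtain ⟨u, hu, hut⟩ := exists_between ht.1
  obtain ⟨v, htv, hv⟩ := exists_between ht.2
  have htuv : t ∈ Set.Ioo u v := ⟨hut, htv⟩
  have hH := isEnergy_ham (h := h) (lam := lam) (C := C) (x := x) hN hβ hu hv
  exact ⟨phiConverges hH htuv, fun a => integrable_overlap_sub_sq hH htuv a (x.q a),
    hasDerivAt_interpPhi hN hβ hu hv htuv⟩

open GaussianSpinGlass in
theorem theorem6 (N : ℕ) (hN : 0 < N) (K : ℕ) (x : StepOrderParameter K)
    (β h lam C : ℝ) (hβ : 0 < β) (hC : C = -β ^ 2 * x.Q)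
    (t : ℝ) (ht : t ∈ Set.Ioo (0 : ℝ) 1) :
    PhiConverges N β h lam C x t ∧
    (∀ a : Fin (K + 1), MeasureTheory.Integrable
      (fun ξ : Noise N K => headWeight β h lam C x t a ξ *
        levelState₂ β h lam C x t a (fun z₁ z₂ => (overlap z₁ z₂ - x.q a) ^ 2) ξ)
      (noiseLaw N K)) ∧
    HasDerivAt (fun s : ℝ => interpPhi N β h lam C x s)
      (β ^ 2 / 4 * ∑ a : Fin (K + 1), (x.m a.succ - x.m a.castSucc) * x.q a ^ 2
        - β ^ 2 / 4 * ∑ a : Fin (K + 1), (x.m a.succ - x.m a.castSucc) *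
            bracket (N := N) β h lam C x t a (fun z₁ z₂ => (overlap z₁ z₂ - x.q a) ^ 2))
      t := by
  simpa only [hC, neg_mul, neg_add_cancel, zero_div, zero_mul, sub_zero] using
    theorem6_general hN.ne' x hβ.ne' h lam C ht
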